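/- Call an $M\times N$ binary matrix \emph{type-2 $(t,\epsilon)$-disjunct} if among the $\binom{N}{t+1}$ sets of $t+1$ columns there are at least $(1-\epsilon)\binom{N}{t+1}$ sets $J$ such that the $M\times(t+1)$ submatrix formed by the columns in $J$ contains $t+1$ rows which form a $(t+1)\times(t+1)$ permutation matrix. Let $a>1$ be a constant. Then there are a constant $C$ and a deterministic polynomial-time algorithm, both depending only on $a$, such that for all integers $1\le t<N$ and all real $\epsilon\le 1$ with $\epsilon>2(t+1)e^{-at}$ the algorithm constructs a type-2 $(t,\epsilon)$-disjunct $M\times N$ matrix with $$M\;\le\; C\,t^{3/2}\,\ln N\;\frac{\sqrt{\ln\frac{2(t+1)}{\epsilon}}}{\ln t-\ln\ln\frac{2(t+1)}{\epsilon}+\ln(4a)} .$$ Here the input of the algorithm consists of $t$, $N$ and a rational number $e$ with $\epsilon/2\le e\le\epsilon$ (for rational $\epsilon$ one may take $e=\epsilon$), and its running time, in the logarithmic cost model of random access machines, is at most a polynomial in $t$, $N$ and the binary length of $e$. -/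

import Mathlib

/-! ## Type-2 almost disjunct matrices -/

/-- The `M × |J|` submatrix of the binary matrix `A` on the columns in `J` contains `|J|` rows which
form a permutation matrix, that is, a square submatrix with exactly one `1` in every row and exactly
one `1` in every column. -/
def ContainsPermMatrix {M N : ℕ} (A : Matrix (Fin M) (Fin N) Bool) (J : Finset (Fin N)) : Prop :=
  ∃ R : Finset (Fin M), R.card = J.card ∧
    (∀ i ∈ R, ∃! j, j ∈ J ∧ A i j = true) ∧
    (∀ j ∈ J, ∃! i, i ∈ R ∧ A i j = true)

/-- `A` is type-2 `(t, ε)`-disjunct: among the `(t + 1)`-sets of columns there is a family of at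
least `(1 - ε) * (N choose (t + 1))` sets on each of which `A` contains a permutation matrix. -/
def IsType2Disjunct {M N : ℕ} (t : ℕ) (ε : ℝ) (A : Matrix (Fin M) (Fin N) Bool) : Prop :=
  ∃ B : Finset (Finset (Fin N)),
    B ⊆ Finset.powersetCard (t + 1) Finset.univ ∧
    (1 - ε) * (N.choose (t + 1) : ℝ) ≤ (B.card : ℝ) ∧
    ∀ J ∈ B, ContainsPermMatrix A J

/-! ## Random access machines with logarithmic cost -/

namespace Ram

/-- The memory: finitely many of the arrays are used by a program, each of them is an infinite
sequence of cells, and each cell holds a natural number. `σ x i` is the content of cell `i` of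
array `x`. -/
abbrev Store := ℕ → ℕ → ℕ

/-- Arithmetic expressions. `read x i` reads a cell of array `x` (indirect addressing). -/
inductive Expr where
  | const (n : ℕ)
  | read (x : ℕ) (i : Expr)
  | add (e₁ e₂ : Expr)
  | sub (e₁ e₂ : Expr)
  | mul (e₁ e₂ : Expr)
  | div (e₁ e₂ : Expr)
  | mod (e₁ e₂ : Expr)

/-- The value of an expression (subtraction is truncated at `0`, division rounds down). -/
def Expr.eval (σ : Store) : Expr → ℕ
  | .const n => n
  | .read x i => σ x (i.eval σ)
  | .add e₁ e₂ => e₁.eval σ + e₂.eval σ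
  | .sub e₁ e₂ => e₁.eval σ - e₂.eval σ
  | .mul e₁ e₂ => e₁.eval σ * e₂.eval σ
  | .div e₁ e₂ => e₁.eval σ / e₂.eval σ
  | .mod e₁ e₂ => e₁.eval σ % e₂.eval σ

/-- The logarithmic cost of evaluating an expression: every operation costs one plus the total
binary length of the numbers it handles, addresses included. -/
def Expr.cost (σ : Store) : Expr → ℕ
  | .const n => 1 + n.size
  | .read x i => i.cost σ + (1 + (i.eval σ).size + (σ x (i.eval σ)).size)
  | .add e₁ e₂ => e₁.cost σ + e₂.cost σ + (1 + (e₁.eval σ).size + (e₂.eval σ).size)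
  | .sub e₁ e₂ => e₁.cost σ + e₂.cost σ + (1 + (e₁.eval σ).size + (e₂.eval σ).size)
  | .mul e₁ e₂ => e₁.cost σ + e₂.cost σ + (1 + (e₁.eval σ).size + (e₂.eval σ).size)
  | .div e₁ e₂ => e₁.cost σ + e₂.cost σ + (1 + (e₁.eval σ).size + (e₂.eval σ).size)
  | .mod e₁ e₂ => e₁.cost σ + e₂.cost σ + (1 + (e₁.eval σ).size + (e₂.eval σ).size)

/-- Programs. `assign x i e` writes the value of `e` into cell `i` of array `x`; a condition holds
if its value is not `0`; `loop e c` is `while e do c`. -/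
inductive Prog where
  | skip
  | assign (x : ℕ) (i e : Expr)
  | seq (c₁ c₂ : Prog)
  | ite (e : Expr) (c₁ c₂ : Prog)
  | loop (e : Expr) (c : Prog)

/-- The store after writing `v` into cell `i` of array `x`. -/
def Store.write (σ : Store) (x i v : ℕ) : Store :=
  Function.update σ x (Function.update (σ x) i v)

/-- `Run c σ σ' T`: started in the store `σ`, the program `c` halts in the store `σ'`, at total
logarithmic cost exactly `T`. -/
inductive Run : Prog → Store → Store → ℕ → Prop where
  | skip (σ : Store) : Run .skip σ σ 1
  | assign (σ : Store) (x : ℕ) (i e : Expr) :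
      Run (.assign x i e) σ (σ.write x (i.eval σ) (e.eval σ))
        (i.cost σ + e.cost σ + (1 + (i.eval σ).size + (e.eval σ).size))
  | seq {c₁ c₂ : Prog} {σ σ₁ σ₂ : Store} {T₁ T₂ : ℕ} :
      Run c₁ σ σ₁ T₁ → Run c₂ σ₁ σ₂ T₂ → Run (.seq c₁ c₂) σ σ₂ (T₁ + T₂)
  | iteTrue {e : Expr} {c₁ c₂ : Prog} {σ σ₁ : Store} {T : ℕ} :
      e.eval σ ≠ 0 → Run c₁ σ σ₁ T → Run (.ite e c₁ c₂) σ σ₁ (e.cost σ + 1 + T)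
  | iteFalse {e : Expr} {c₁ c₂ : Prog} {σ σ₁ : Store} {T : ℕ} :
      e.eval σ = 0 → Run c₂ σ σ₁ T → Run (.ite e c₁ c₂) σ σ₁ (e.cost σ + 1 + T)
  | loopTrue {e : Expr} {c : Prog} {σ σ₁ σ₂ : Store} {T₁ T₂ : ℕ} :
      e.eval σ ≠ 0 → Run c σ σ₁ T₁ → Run (.loop e c) σ₁ σ₂ T₂ →
        Run (.loop e c) σ σ₂ (e.cost σ + 1 + T₁ + T₂)
  | loopFalse {e : Expr} {c : Prog} {σ : Store} :
      e.eval σ = 0 → Run (.loop e c) σ σ (e.cost σ + 1)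

/-- Programs are deterministic: the final store and the cost are determined by the initial store. -/
theorem Run.deterministic {c : Prog} {σ σ₁ σ₂ : Store} {T₁ T₂ : ℕ}
    (h₁ : Run c σ σ₁ T₁) (h₂ : Run c σ σ₂ T₂) : σ₁ = σ₂ ∧ T₁ = T₂ := by
  induction h₁ generalizing σ₂ T₂ with
  | skip σ => cases h₂; exact ⟨rfl, rfl⟩
  | assign σ x i e => cases h₂; exact ⟨rfl, rfl⟩
  | seq _ _ ih₁ ih₂ =>
    cases h₂ with
    | seq k₁ k₂ =>
      obtain ⟨rfl, rfl⟩ := ih₁ k₁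
      obtain ⟨rfl, rfl⟩ := ih₂ k₂
      exact ⟨rfl, rfl⟩
  | iteTrue he _ ih =>
    cases h₂ with
    | iteTrue _ k => obtain ⟨rfl, rfl⟩ := ih k; exact ⟨rfl, rfl⟩
    | iteFalse he' _ => exact absurd he' he
  | iteFalse he _ ih =>
    cases h₂ with
    | iteTrue he' _ => exact absurd he he'
    | iteFalse _ k => obtain ⟨rfl, rfl⟩ := ih k; exact ⟨rfl, rfl⟩
  | loopTrue he _ _ ih₁ ih₂ =>
    cases h₂ with
    | loopTrue _ k₁ k₂ =>
      obtain ⟨rfl, rfl⟩ := ih₁ k₁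
      obtain ⟨rfl, rfl⟩ := ih₂ k₂
      exact ⟨rfl, rfl⟩
    | loopFalse he' => exact absurd he' he
  | loopFalse he =>
    cases h₂ with
    | loopTrue he' _ _ => exact absurd he he'
    | loopFalse _ => exact ⟨rfl, rfl⟩

/-- The initial store for an input list: array `0` holds the input, all other cells hold `0`. -/
def Store.ofInput (l : List ℕ) : Store :=
  fun x i => if x = 0 then l.getD i 0 else 0

/-- On the given input, the program `P` halts within total cost `T` and outputs the binary
`M × N` matrix `A`: it leaves the number of rows `M` in cell `0` of array `1` and the entries of `A`,
row by row, in array `2`. -/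
def OutputsMatrixWithin (P : Prog) (input : List ℕ) {M N : ℕ}
    (A : Matrix (Fin M) (Fin N) Bool) (T : ℕ) : Prop :=
  ∃ (σ : Store) (T' : ℕ), Run P (Store.ofInput input) σ T' ∧ T' ≤ T ∧
    σ 1 0 = M ∧ ∀ (i : Fin M) (j : Fin N), σ 2 ((i : ℕ) * N + (j : ℕ)) = (A i j).toNat

end Ram

/-! Write `L = log (2 (t + 1) / ε)`; the hypothesis on `ε` says `L < a t`. The program builds a code of
length `m = O(L log N)` over `q = O(t + L)` symbols and replaces each symbol by a unit column of
length `q`. This gives `M = q m = O(t L log N)` rows, which is within the required bound because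
`log x ≤ 2 √x` for `x = 4 a t / L` (`mul_le_sqrt_div_log`).

*The code.* The columns are split into blocks of `q` consecutive ones. In row `i` the column `j` of
block `b` has the symbol `j + u mod q`, where the shift `u = U (b m + i)` depends only on the block.
So each symbol occurs at most once per block and row, and on average two columns agree in at most
`m / q` rows, whatever the shifts are (`sum_agreement_le`). The shifts are chosen greedily, block by
block and row by row, by the method of conditional expectations: for the current block the weight of
(earlier block, residue `d`) is `2` to the number of rows so far in which the two shifts differ by
`d`. A shift of at most average cost multiplies the total weight by at most `1 + 1 / q`
(`RowInv.step`), so that any two columns agree in at most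
`lam = (log N + m / q) / log 2` rows (`agreement_le`).

*Disjunctness.* A column `j` of `J` has a private row as soon as its agreements with the other columns
of `J` add up to less than `m`. For random `J` this is the sum of `t` samples without replacement from
numbers in `[0, lam]` with mean at most `m / q`. Maclaurin's inequality
(`sum_powersetCard_prod_le`) bounds its exponential moment as if the samples were independent, so the
sum reaches `m` with probability at most `exp (-m / (2 lam)) ≤ exp (-L)`, and a union bound over the
`t + 1` columns of `J` gives `ε / 2` (`isType2Disjunct_codeMatrix`).

*Running time.* If all memory cells have at most `S` bits, evaluating an expression costs at most a
constant times `S + 1` (`Ram.Expr.cost_le_weight`). So it suffices to bound the cells by `2 ^ S` and to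
count elementary steps, which `Ram.Halts` does; the weights are at most `2 ^ m`, so `S` is polynomial in
the length of the input (`Ram.constructProg_halts`). -/

/-! ### Programs with bounded memory: a Hoare logic with costs -/

namespace Ram

/-- Every memory cell holds a number of binary length at most `S`. -/
def Mem (S : ℕ) (σ : Store) : Prop := ∀ x i, σ x i < 2 ^ S

/-- A syntactic constant such that evaluating the expression in a memory whose cells have binary
length at most `S` costs at most `weight * (S + 1)`. -/
def Expr.weight : Expr → ℕ
  | .const n => 1 + n
  | .read _ i => 2 * i.weight + 2
  | .add e₁ e₂ => 2 * (e₁.weight + e₂.weight) + 1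
  | .sub e₁ e₂ => 2 * (e₁.weight + e₂.weight) + 1
  | .mul e₁ e₂ => 2 * (e₁.weight + e₂.weight) + 1
  | .div e₁ e₂ => 2 * (e₁.weight + e₂.weight) + 1
  | .mod e₁ e₂ => 2 * (e₁.weight + e₂.weight) + 1

theorem size_add_le (a b : ℕ) : (a + b).size ≤ 1 + a.size + b.size := by
  rw [Nat.size_le]
  have h₁ := Nat.lt_size_self a
  have h₂ := Nat.lt_size_self b
  have h₃ : 2 ^ a.size ≤ 2 ^ (a.size + b.size) := Nat.pow_le_pow_right (by norm_num) (by omega)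
  have h₄ : 2 ^ b.size ≤ 2 ^ (a.size + b.size) := Nat.pow_le_pow_right (by norm_num) (by omega)
  have h₅ : 2 ^ (1 + a.size + b.size) = 2 * 2 ^ (a.size + b.size) := by ring
  omega

theorem size_mul_le (a b : ℕ) : (a * b).size ≤ a.size + b.size := by
  rw [Nat.size_le, pow_add]
  exact Nat.mul_lt_mul'' (Nat.lt_size_self a) (Nat.lt_size_self b)

/-- The cost of an expression pays for the length of its value, so `cost` alone controls the cost of
the operations applied to it. -/
theorem Expr.size_eval_le_cost (σ : Store) (e : Expr) : (e.eval σ).size ≤ e.cost σ := by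
  induction e with
  | const n => simp [Expr.eval, Expr.cost]
  | read x i _ => simp only [Expr.eval, Expr.cost]; omega
  | add e₁ e₂ _ _ =>
    have := size_add_le (e₁.eval σ) (e₂.eval σ)
    simp only [Expr.eval, Expr.cost]; omega
  | mul e₁ e₂ _ _ =>
    have := size_mul_le (e₁.eval σ) (e₂.eval σ)
    simp only [Expr.eval, Expr.cost]; omega
  | sub e₁ e₂ _ _ =>
    have := Nat.size_le_size (Nat.sub_le (e₁.eval σ) (e₂.eval σ))
    simp only [Expr.eval, Expr.cost]; omega
  | div e₁ e₂ _ _ =>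
    have := Nat.size_le_size (Nat.div_le_self (e₁.eval σ) (e₂.eval σ))
    simp only [Expr.eval, Expr.cost]; omega
  | mod e₁ e₂ _ _ =>
    have := Nat.size_le_size (Nat.mod_le (e₁.eval σ) (e₂.eval σ))
    simp only [Expr.eval, Expr.cost]; omega

theorem Expr.cost_le_weight {S : ℕ} {σ : Store} (hσ : Mem S σ) (e : Expr) :
    e.cost σ ≤ e.weight * (S + 1) := by
  induction e with
  | const n =>
    have : n.size ≤ n := Nat.size_le.2 Nat.lt_two_pow_self
    simp only [Expr.cost, Expr.weight]
    nlinarith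
  | read x i ih =>
    have h₁ := i.size_eval_le_cost σ
    have h₂ := Nat.size_le.2 (hσ x (i.eval σ))
    simp only [Expr.cost, Expr.weight]
    linarith
  | add e₁ e₂ ih₁ ih₂ | sub e₁ e₂ ih₁ ih₂ | mul e₁ e₂ ih₁ ih₂ | div e₁ e₂ ih₁ ih₂
  | mod e₁ e₂ ih₁ ih₂ =>
    have h₁ := e₁.size_eval_le_cost σ
    have h₂ := e₂.size_eval_le_cost σ
    simp only [Expr.cost, Expr.weight]
    linarith

/-- The arrays a program may write to. -/
def Prog.writes : Prog → List ℕ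
  | .skip => []
  | .assign x _ _ => [x]
  | .seq c₁ c₂ => c₁.writes ++ c₂.writes
  | .ite _ c₁ c₂ => c₁.writes ++ c₂.writes
  | .loop _ c => c.writes

theorem Store.write_of_ne {x y : ℕ} (h : y ≠ x) (σ : Store) (i v : ℕ) :
    σ.write x i v y = σ y := by
  simp [Store.write, h]

theorem Store.write_self (σ : Store) (x i v : ℕ) :
    σ.write x i v x = Function.update (σ x) i v := by
  simp [Store.write]

theorem Run.frame {c : Prog} {σ σ' : Store} {T : ℕ} (h : Run c σ σ' T) {y : ℕ}
    (hy : y ∉ c.writes) : σ' y = σ y := by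
  induction h with
  | skip σ => rfl
  | assign σ x i e => exact Store.write_of_ne (by simpa [Prog.writes] using hy) _ _ _
  | seq _ _ ih₁ ih₂ =>
    simp only [Prog.writes, List.mem_append, not_or] at hy
    rw [ih₂ hy.2, ih₁ hy.1]
  | iteTrue _ _ ih =>
    simp only [Prog.writes, List.mem_append, not_or] at hy
    exact ih hy.1
  | iteFalse _ _ ih =>
    simp only [Prog.writes, List.mem_append, not_or] at hy
    exact ih hy.2
  | loopTrue _ _ _ ih₁ ih₂ => rw [ih₂ hy, ih₁ hy]
  | loopFalse _ => rfl

theorem Mem.write {S : ℕ} {σ : Store} (hσ : Mem S σ) {v : ℕ} (hv : v < 2 ^ S) (x i : ℕ) :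
    Mem S (σ.write x i v) := by
  intro y j
  unfold Store.write
  by_cases hy : y = x
  · subst hy
    by_cases hj : j = i
    · subst hj; simpa using hv
    · simpa [hj] using hσ y j
  · simpa [hy] using hσ y j

/-- Total correctness with a cost bound: started in `σ`, the program `c` halts at cost at most
`K * (S + 1)`, in a store whose cells have binary length at most `S` and which satisfies `Q`. -/
def Halts (S K : ℕ) (c : Prog) (σ : Store) (Q : Store → Prop) : Prop :=
  ∃ (σ' : Store) (T : ℕ), Run c σ σ' T ∧ T ≤ K * (S + 1) ∧ Mem S σ' ∧ Q σ'

namespace Halts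

variable {S K K₁ K₂ : ℕ} {c c₁ c₂ : Prog} {σ : Store} {Q R : Store → Prop}

theorem mono (h : Halts S K₁ c σ Q) (hK : K₁ ≤ K₂) (hQ : ∀ τ, Mem S τ → Q τ → R τ) :
    Halts S K₂ c σ R := by
  obtain ⟨σ', T, hr, hT, hm, hq⟩ := h
  exact ⟨σ', T, hr, hT.trans (Nat.mul_le_mul_right _ hK), hm, hQ _ hm hq⟩

theorem frame (h : Halts S K c σ Q) :
    Halts S K c σ (fun τ => Q τ ∧ ∀ y, y ∉ c.writes → τ y = σ y) := by
  obtain ⟨σ', T, hr, hT, hm, hq⟩ := h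
  exact ⟨σ', T, hr, hT, hm, hq, fun y hy => hr.frame hy⟩

theorem skip (hσ : Mem S σ) (hQ : Q σ) : Halts S 1 .skip σ Q :=
  ⟨σ, 1, .skip σ, by omega, hσ, hQ⟩

theorem assign {x : ℕ} {i e : Expr} (hσ : Mem S σ) (he : e.eval σ < 2 ^ S)
    (hQ : Q (σ.write x (i.eval σ) (e.eval σ))) :
    Halts S (2 * i.weight + 2 * e.weight + 1) (.assign x i e) σ Q := by
  refine ⟨_, _, .assign σ x i e, ?_, hσ.write he _ _, hQ⟩
  have h₁ := Expr.cost_le_weight hσ i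
  have h₂ := Expr.cost_le_weight hσ e
  have h₃ := i.size_eval_le_cost σ
  have h₄ := e.size_eval_le_cost σ
  linarith

theorem seq (h₁ : Halts S K₁ c₁ σ R) (h₂ : ∀ τ, Mem S τ → R τ → Halts S K₂ c₂ τ Q) :
    Halts S (K₁ + K₂) (.seq c₁ c₂) σ Q := by
  obtain ⟨τ, T₁, hr₁, hT₁, hm₁, hR⟩ := h₁
  obtain ⟨τ', T₂, hr₂, hT₂, hm₂, hQ⟩ := h₂ τ hm₁ hR
  exact ⟨τ', _, .seq hr₁ hr₂, by linarith, hm₂, hQ⟩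

theorem ite {e : Expr} (hσ : Mem S σ) (h₁ : e.eval σ ≠ 0 → Halts S K₁ c₁ σ Q)
    (h₂ : e.eval σ = 0 → Halts S K₂ c₂ σ Q) :
    Halts S (e.weight + 1 + K₁ + K₂) (.ite e c₁ c₂) σ Q := by
  have hc := Expr.cost_le_weight hσ e
  by_cases he : e.eval σ = 0
  · obtain ⟨τ, T, hr, hT, hm, hQ⟩ := h₂ he
    exact ⟨τ, _, .iteFalse he hr, by nlinarith, hm, hQ⟩
  · obtain ⟨τ, T, hr, hT, hm, hQ⟩ := h₁ he
    exact ⟨τ, _, .iteTrue he hr, by nlinarith, hm, hQ⟩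

/-- A `while` loop with invariant `I k`, where `k` bounds the number of iterations still to come. -/
theorem loop {e : Expr} {I : ℕ → Store → Prop}
    (hstep : ∀ k τ, Mem S τ → I k τ → e.eval τ ≠ 0 →
      ∃ k', k = k' + 1 ∧ Halts S K c τ (I k'))
    (hdone : ∀ k τ, Mem S τ → I k τ → e.eval τ = 0 → Q τ) (n : ℕ) :
    ∀ σ, Mem S σ → I n σ → Halts S ((n + 1) * (K + e.weight + 1)) (.loop e c) σ Q := by
  induction n with
  | zero =>
    intro σ hσ hI
    by_cases he : e.eval σ = 0
    · have hc := Expr.cost_le_weight hσ e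
      exact ⟨σ, _, .loopFalse he, by nlinarith, hσ, hdone _ _ hσ hI he⟩
    · obtain ⟨k', hk', -⟩ := hstep _ _ hσ hI he
      omega
  | succ n ih =>
    intro σ hσ hI
    have hc := Expr.cost_le_weight hσ e
    by_cases he : e.eval σ = 0
    · refine ⟨σ, _, .loopFalse he, ?_, hσ, hdone _ _ hσ hI he⟩
      calc e.cost σ + 1 ≤ 1 * (e.weight + 1) * (S + 1) := by linarith
        _ ≤ (n + 1 + 1) * (K + e.weight + 1) * (S + 1) := by gcongr <;> omega
    · obtain ⟨k', hk', τ, T₁, hr₁, hT₁, hm₁, hI₁⟩ := hstep _ _ hσ hI he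
      obtain rfl : n = k' := by omega
      obtain ⟨τ', T₂, hr₂, hT₂, hm₂, hQ⟩ := ih τ hm₁ hI₁
      refine ⟨τ', _, .loopTrue he hr₁ hr₂, ?_, hm₂, hQ⟩
      have : (n + 1 + 1) * (K + e.weight + 1) * (S + 1)
          = (n + 1) * (K + e.weight + 1) * (S + 1) + K * (S + 1) + e.weight * (S + 1) + (S + 1) := by
        ring
      omega

end Halts

/-- The variable `x`, that is, cell `0` of the array `x`. -/
abbrev Expr.var (x : ℕ) : Expr := .read x (.const 0)

/-- Assignment to the variable `x`. -/
abbrev Prog.set (x : ℕ) (e : Expr) : Prog := .assign x (.const 0) e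

theorem Halts.set {S x v : ℕ} {e : Expr} {σ : Store} (hσ : Mem S σ) (hv : e.eval σ = v)
    (hvS : v < 2 ^ S) :
    Halts S (2 * e.weight + 3) (.set x e) σ
      (fun τ => τ x 0 = v ∧ ∀ y, y ≠ x → τ y = σ y) := by
  subst hv
  refine (Halts.assign (i := .const 0) (Q := fun τ => τ x 0 = e.eval σ ∧ ∀ y, y ≠ x → τ y = σ y)
    hσ hvS ⟨by simp [Store.write, Expr.eval], fun y hy => Store.write_of_ne hy _ _ _⟩).mono ?_
    (fun _ _ h => h)
  simp only [Expr.weight]; omega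

/-- `for v = 0, …, n - 1 do c`. -/
def Prog.forLoop (v : ℕ) (n : Expr) (c : Prog) : Prog :=
  .seq (.set v (.const 0))
    (.loop (.sub n (.var v)) (.seq c (.set v (.add (.var v) (.const 1)))))

/-- The rule for `for` loops: `I k` is an invariant of the store after `k` iterations that does not
depend on the loop variable, and the body writes neither the loop variable nor anything that the
number of iterations depends on. -/
theorem Halts.forLoop {S K v n₀ : ℕ} {n : Expr} {c : Prog} {I : ℕ → Store → Prop} {σ : Store}
    (hσ : Mem S σ) (hn₀ : n₀ < 2 ^ S) (hv : v ∉ c.writes)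
    (hn : ∀ τ : Store, (∀ y, y ≠ v → y ∉ c.writes → τ y = σ y) → n.eval τ = n₀)
    (hI : ∀ k τ x, I k τ → I k (Store.write τ v 0 x)) (h₀ : I 0 σ)
    (hstep : ∀ k τ, k < n₀ → Mem S τ → I k τ → τ v 0 = k →
      (∀ y, y ≠ v → y ∉ c.writes → τ y = σ y) → Halts S K c τ (I (k + 1))) :
    Halts S ((n₀ + 1) * (K + 2 * n.weight + 44)) (Prog.forLoop v n c) σ (I n₀) := by
  have hS : 0 < 2 ^ S := by positivity
  have key := Halts.loop (S := S) (K := K + 29) (e := .sub n (.var v))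
    (c := .seq c (.set v (.add (.var v) (.const 1)))) (Q := I n₀)
    (I := fun j τ => ∃ k, k + j = n₀ ∧ I k τ ∧ τ v 0 = k ∧
      ∀ y, y ≠ v → y ∉ c.writes → τ y = σ y) ?_ ?_ n₀ (σ.write v 0 0) (hσ.write hS _ _)
    ⟨0, by omega, hI _ _ _ h₀, by simp [Store.write],
      fun y hy _ => Store.write_of_ne hy _ _ _⟩
  · have h₁ : Halts S 5 (.set v (.const 0)) σ (fun τ => τ = σ.write v 0 0) :=
      Halts.assign (i := .const 0) (e := .const 0) hσ hS rfl
    refine (h₁.seq fun τ _ hτ => hτ ▸ key).mono ?_ (fun _ _ h => h)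
    simp only [Expr.weight]
    nlinarith
  · rintro j τ hτ ⟨k, hk, hIk, hvk, hfr⟩ he
    have hb := hn τ hfr
    simp only [Expr.eval, hb, hvk] at he
    refine ⟨j - 1, by omega, ((hstep k τ (by omega) hτ hIk hvk hfr).frame).seq ?_⟩
    rintro τ₁ hτ₁ ⟨hI₁, hfr₁⟩
    have hv₁ : τ₁ v 0 = k := by rw [hfr₁ v hv, hvk]
    refine Halts.assign (i := .const 0) hτ₁ ?_ ?_
    · simp only [Expr.eval, hv₁]; omega
    · refine ⟨k + 1, by omega, hI _ _ _ hI₁, ?_, fun y hy hy' => ?_⟩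
      · simp [Store.write, Expr.eval, hv₁]
      · rw [Store.write_of_ne hy, hfr₁ y hy', hfr y hy hy']
  · rintro j τ hτ ⟨k, hk, hIk, hvk, hfr⟩ he
    have hb := hn τ hfr
    simp only [Expr.eval, hb, hvk] at he
    obtain rfl : k = n₀ := by omega
    exact hIk

end Ram

section Code

open Finset

/-! ### Weights of shifts -/

/-- The total weight of the cells `c * q + (u - U (c * m + i)) mod q`, `c < b`. -/
def shiftCost (q m b i : ℕ) (W U : ℕ → ℕ) (u : ℕ) : ℕ :=
  ∑ c ∈ range b, W (c * q + (u + q - U (c * m + i)) % q)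

/-- The total weight of the first `b` blocks of `q` cells. -/
def totalWeight (q b : ℕ) (W : ℕ → ℕ) : ℕ := ∑ c ∈ range b, ∑ d ∈ range q, W (c * q + d)

/-- The number of rows `i < k` in which the shifts of the blocks `b` and `c` differ by `d`
modulo `q`. The shift of the block `b` in row `i` is stored as `U (b * m + i)`. -/
def hits (q m : ℕ) (U : ℕ → ℕ) (b c d k : ℕ) : ℕ :=
  #{i ∈ range k | (U (b * m + i) + q - U (c * m + i)) % q = d}

theorem mod_sub_add_cancel {q u v : ℕ} (hu : u < q) (hv : v < q) :
    ((u + q - v) % q + v) % q = u := by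
  rw [Nat.mod_add_mod, Nat.sub_add_cancel (by omega), Nat.add_mod_right, Nat.mod_eq_of_lt hu]

theorem mod_add_sub_cancel {q d v : ℕ} (hd : d < q) (hv : v < q) :
    ((d + v) % q + q - v) % q = d := by
  rcases lt_or_ge (d + v) q with h | h
  · rw [Nat.mod_eq_of_lt h, show d + v + q - v = d + q by omega, Nat.add_mod_right,
      Nat.mod_eq_of_lt hd]
  · rw [Nat.mod_eq_sub_mod h, Nat.mod_eq_of_lt (show d + v - q < q by omega),
      show d + v - q + q - v = d by omega, Nat.mod_eq_of_lt hd]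

theorem sum_shift {q v : ℕ} (hv : v < q) (f : ℕ → ℕ) :
    ∑ u ∈ range q, f ((u + q - v) % q) = ∑ d ∈ range q, f d := by
  have hq : 0 < q := by omega
  refine sum_nbij' (fun u => (u + q - v) % q) (fun d => (d + v) % q) ?_ ?_ ?_ ?_ ?_
  · intro u _; exact mem_range.2 (Nat.mod_lt _ hq)
  · intro d _; exact mem_range.2 (Nat.mod_lt _ hq)
  · intro u hu; exact mod_sub_add_cancel (mem_range.1 hu) hv
  · intro d hd; exact mod_add_sub_cancel (mem_range.1 hd) hv
  · intro u _; rfl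

theorem sum_shiftCost {q m b i : ℕ} {W U : ℕ → ℕ} (hU : ∀ c < b, U (c * m + i) < q) :
    ∑ u ∈ range q, shiftCost q m b i W U u = totalWeight q b W := by
  unfold shiftCost totalWeight
  rw [sum_comm]
  exact sum_congr rfl fun c hc => sum_shift (hU c (mem_range.1 hc)) fun d => W (c * q + d)

/-- A shift of at most average cost. -/
theorem exists_shiftCost_le {q m b i : ℕ} {W U : ℕ → ℕ} (hq : 0 < q)
    (hU : ∀ c < b, U (c * m + i) < q) :
    ∃ u < q, q * shiftCost q m b i W U u ≤ totalWeight q b W := by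
  by_contra! h
  have h₁ : ∑ u ∈ range q, totalWeight q b W < ∑ u ∈ range q, q * shiftCost q m b i W U u :=
    sum_lt_sum_of_nonempty (nonempty_range_iff.2 hq.ne') fun u hu => h u (mem_range.1 hu)
  rw [← mul_sum, sum_shiftCost hU, sum_const, card_range, smul_eq_mul] at h₁
  exact lt_irrefl _ h₁

theorem block_index_inj {q c c' d d' : ℕ} (hd : d < q) (hd' : d' < q)
    (h : c * q + d = c' * q + d') : c = c' ∧ d = d' := by
  have hq : 0 < q := by omega
  have h₁ := congrArg (· / q) h
  simp only [mul_comm _ q, Nat.mul_add_div hq, Nat.div_eq_of_lt hd, Nat.div_eq_of_lt hd',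
    add_zero] at h₁
  subst h₁
  exact ⟨rfl, by omega⟩

theorem shiftCost_le {q m b i : ℕ} {W U : ℕ → ℕ} (hq : 0 < q) (u : ℕ) {k : ℕ} (hk : k ≤ b) :
    shiftCost q m k i W U u ≤ totalWeight q b W := by
  refine (sum_le_sum fun c _ => ?_).trans
    (sum_le_sum_of_subset (f := fun c => ∑ d ∈ range q, W (c * q + d)) (range_mono hk))
  exact single_le_sum (f := fun d => W (c * q + d)) (fun _ _ => Nat.zero_le _)
    (mem_range.2 (Nat.mod_lt _ hq))

theorem le_totalWeight {q b c d : ℕ} (W : ℕ → ℕ) (hc : c < b) (hd : d < q) :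
    W (c * q + d) ≤ totalWeight q b W :=
  (single_le_sum (f := fun d => W (c * q + d)) (fun _ _ => Nat.zero_le _)
    (mem_range.2 hd)).trans
    (single_le_sum (f := fun c => ∑ d ∈ range q, W (c * q + d)) (fun _ _ => Nat.zero_le _)
      (mem_range.2 hc))

/-- Doubling the weights of the chosen cells adds their cost to the total weight. -/
theorem totalWeight_double {q m b i u : ℕ} {W W' U : ℕ → ℕ} (hq : 0 < q)
    (hW : ∀ c < b, ∀ d < q, W' (c * q + d) =
      if d = (u + q - U (c * m + i)) % q then 2 * W (c * q + d) else W (c * q + d)) :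
    totalWeight q b W' = totalWeight q b W + shiftCost q m b i W U u := by
  unfold totalWeight shiftCost
  rw [← sum_add_distrib]
  refine sum_congr rfl fun c hc => ?_
  have h : ∀ d ∈ range q, W' (c * q + d) = W (c * q + d) +
      if d = (u + q - U (c * m + i)) % q then W (c * q + d) else 0 := by
    intro d hd
    rw [hW c (mem_range.1 hc) d (mem_range.1 hd)]
    split_ifs <;> omega
  rw [sum_congr rfl h, sum_add_distrib, sum_ite_eq' (range q),
    if_pos (mem_range.2 (Nat.mod_lt _ hq))]

/-! ### Programs for one row of the code

The variables are cell `0` of the arrays `3` (`q`), `4` (`m`), `5` (the logarithm of `2 (t + 1) / e`),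
`6` (current block), `7` (current row), `8` (candidate shift), `9` (earlier block), `10` (cost of the
candidate), `11` (chosen shift), `12` (total weight), `15`, `16`, `17`, `18` (temporaries and loop
variables) and `19` (the logarithm of `N`). Array `13` holds the weights and array `14` the shifts. -/

namespace Ram

/-- Sets the variable `l` to the binary logarithm of `e` by repeated halving, with `x` as temporary
variable. -/
def logProg (x l : ℕ) (e : Expr) : Prog :=
  .seq (.set x e) (.seq (.set l (.const 0))
    (.loop (.div (.var x) (.const 2))
      (.seq (.set x (.div (.var x) (.const 2))) (.set l (.add (.var l) (.const 1))))))

theorem logProg_halts {S x l v : ℕ} {e : Expr} {σ : Store} (hxl : x ≠ l) (hσ : Mem S σ)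
    (hv : e.eval σ = v) (he : v < 2 ^ S) :
    Halts S (2 * e.weight + 100 * (Nat.log 2 v + 2)) (logProg x l e) σ
      (fun τ => τ l 0 = Nat.log 2 v) := by
  subst hv
  have hS : 0 < 2 ^ S := by positivity
  have hlog : Nat.log 2 (e.eval σ) < 2 ^ S :=
    (Nat.log_le_self 2 _).trans_lt he
  refine Halts.mono (Halts.seq (Halts.set hσ rfl he) fun τ hτ hx => Halts.seq
    (Halts.set hτ (v := 0) rfl hS) fun τ' hτ' h => Halts.loop (K := 62)
      (I := fun k τ => k = Nat.log 2 (τ x 0) ∧ τ l 0 + k = Nat.log 2 (e.eval σ))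
      ?_ ?_ (Nat.log 2 (e.eval σ)) τ' hτ' ?_) ?_ (fun _ _ h => h)
  · rintro k τ hτ ⟨hk, hl⟩ hne
    simp only [Expr.eval] at hne
    have hx2 : 2 ≤ τ x 0 := by
      by_contra h
      exact hne (Nat.div_eq_of_lt (by omega))
    have hk1 : 1 ≤ k := by rw [hk]; exact Nat.log_pos (by norm_num) hx2
    refine ⟨k - 1, by omega, Halts.mono (Halts.seq (Halts.set hτ (v := τ x 0 / 2) rfl
      ((Nat.div_le_self _ _).trans_lt (hτ x 0))) fun τ₁ hτ₁ h₁ => Halts.mono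
      (Halts.set hτ₁ (v := τ l 0 + 1) ?_ ?_) le_rfl fun τ₂ _ h₂ => ?_) ?_ fun _ _ h => h⟩
    · simp only [Expr.eval, h₁.2 l hxl.symm]
    · omega
    · rw [h₂.2 x hxl, h₁.1, h₂.1, Nat.log_div_base]
      omega
    · simp [Expr.weight]
  · rintro k τ hτ ⟨hk, hl⟩ h0
    simp only [Expr.eval] at h0
    have : Nat.log 2 (τ x 0) = 0 := Nat.log_of_lt (by omega)
    omega
  · rw [h.2 x hxl, hx.1, h.1]; simp
  · simp only [Expr.weight]; omega

/-- The cell number `c * q + (u - U[c * m + i]) mod q`, where `u` is the variable `x`. -/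
def slotExpr (x : ℕ) : Expr :=
  .add (.mul (.var 9) (.var 3)) (.mod (.sub (.add (.var x) (.var 3))
    (.read 14 (.add (.mul (.var 9) (.var 4)) (.var 7)))) (.var 3))

/-- Computes the cost of the shift stored in variable `8`. -/
def costProg : Prog :=
  .seq (.set 10 (.const 0))
    (.forLoop 9 (.var 6) (.set 10 (.add (.var 10) (.read 13 (slotExpr 8)))))

theorem costProg_halts {S q m b i u : ℕ} {σ : Store} (hσ : Mem S σ) (hq : 0 < q)
    (h3 : σ 3 0 = q) (h4 : σ 4 0 = m) (h6 : σ 6 0 = b) (h7 : σ 7 0 = i) (h8 : σ 8 0 = u)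
    (hS : totalWeight q b (σ 13) < 2 ^ S) :
    Halts S ((b + 1) * 10000) costProg σ
      (fun τ => τ 10 0 = shiftCost q m b i (σ 13) (σ 14) u) := by
  have hS0 : 0 < 2 ^ S := by positivity
  refine Halts.mono (Halts.seq (Halts.set hσ (v := 0) rfl hS0) fun τ hτ h => Halts.forLoop
      (I := fun k τ => τ 10 0 = shiftCost q m k i (σ 13) (σ 14) u) (n₀ := b) hτ
      (h6 ▸ hσ 6 0) (by decide) ?_ ?_ ?_ ?_ (K := 8000)) ?_ (fun _ _ h => h)
  · intro τ' hτ'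
    simp only [Expr.eval]
    rw [hτ' 6 (by decide) (by decide), h.2 6 (by decide), h6]
  · intro k τ x hk
    rwa [Store.write_of_ne (by decide)]
  · rw [h.1]; simp [shiftCost]
  · intro k τ' hk hτ' hI h9 hfr
    have f : ∀ y, y ≠ 9 → y ≠ 10 → τ' y = σ y := fun y hy hy' => by
      rw [hfr y hy (by simpa [Prog.writes] using hy'), h.2 y hy']
    have hv : (Expr.add (.var 10) (.read 13 (slotExpr 8))).eval τ' =
        shiftCost q m (k + 1) i (σ 13) (σ 14) u := by
      simp only [Expr.eval, slotExpr, hI, h9, f 3 (by decide) (by decide),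
        f 4 (by decide) (by decide), f 7 (by decide) (by decide), f 8 (by decide) (by decide),
        f 13 (by decide) (by decide), f 14 (by decide) (by decide), h3, h4, h7, h8]
      rw [shiftCost, shiftCost, sum_range_succ]
    refine Halts.mono (Halts.set hτ' hv ((shiftCost_le hq u hk).trans_lt hS)) ?_ (fun _ _ h => h.1)
    simp [Expr.weight, slotExpr]
  · simp [Expr.weight]; omega

/-- Stores in variable `11` a shift whose cost is at most the average. As subtraction is truncated, the
condition `tot + 1 - q * cost ≠ 0` says `q * cost ≤ tot`. -/
def searchProg : Prog :=
  .seq (.set 11 (.const 0)) (.forLoop 8 (.var 3) (.seq costProg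
    (.ite (.sub (.add (.var 12) (.const 1)) (.mul (.var 3) (.var 10)))
      (.set 11 (.var 8)) .skip)))

theorem searchProg_halts {S q m b i : ℕ} {σ : Store} (hσ : Mem S σ) (hq : 0 < q)
    (h3 : σ 3 0 = q) (h4 : σ 4 0 = m) (h6 : σ 6 0 = b) (h7 : σ 7 0 = i)
    (h12 : σ 12 0 = totalWeight q b (σ 13)) (hU : ∀ c < b, σ 14 (c * m + i) < q) :
    Halts S ((q + 1) * ((b + 1) * 11000)) searchProg σ
      (fun τ => τ 11 0 < q ∧
        q * shiftCost q m b i (σ 13) (σ 14) (τ 11 0) ≤ totalWeight q b (σ 13)) := by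
  have hS0 : 0 < 2 ^ S := by positivity
  have hqS : q < 2 ^ S := h3 ▸ hσ 3 0
  refine Halts.mono (Halts.seq (Halts.set hσ (v := 0) rfl hS0) fun τ hτ h => Halts.forLoop
      (I := fun k τ => τ 11 0 < q ∧
        ∀ u < k, q * shiftCost q m b i (σ 13) (σ 14) u ≤ totalWeight q b (σ 13) →
          q * shiftCost q m b i (σ 13) (σ 14) (τ 11 0) ≤ totalWeight q b (σ 13)) (n₀ := q) hτ
      hqS (by decide) ?_ ?_ ?_ ?_ (K := (b + 1) * 10000 + 200)) ?_ ?_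
  · intro τ' hτ'
    simp only [Expr.eval]
    rw [hτ' 3 (by decide) (by decide), h.2 3 (by decide), h3]
  · intro k τ x hk
    rwa [Store.write_of_ne (by decide)]
  · exact ⟨by rw [h.1]; exact hq, fun u hu => absurd hu (by omega)⟩
  · intro k τ' hk hτ' hI h8 hfr
    have f : ∀ y, y ≠ 8 → y ≠ 9 → y ≠ 10 → y ≠ 11 → τ' y = σ y := fun y h1 h2 h3 h4 => by
      rw [hfr y h1 (by simp [Prog.writes, costProg, Prog.forLoop, *]), h.2 y h4]
    have hcost := costProg_halts (S := S) (q := q) (m := m) (b := b) (i := i) (u := k) hτ' hq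
      (by rw [f 3 (by decide) (by decide) (by decide) (by decide), h3])
      (by rw [f 4 (by decide) (by decide) (by decide) (by decide), h4])
      (by rw [f 6 (by decide) (by decide) (by decide) (by decide), h6])
      (by rw [f 7 (by decide) (by decide) (by decide) (by decide), h7]) h8
      (by rw [f 13 (by decide) (by decide) (by decide) (by decide), ← h12]; exact hσ 12 0)
    rw [f 13 (by decide) (by decide) (by decide) (by decide),
      f 14 (by decide) (by decide) (by decide) (by decide)] at hcost
    refine Halts.seq hcost.frame (K₂ := 200) fun τ₂ hτ₂ h₂ => ?_
    have e₁₂ : τ₂ 12 0 = totalWeight q b (σ 13) := by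
      rw [h₂.2 12 (by decide), f 12 (by decide) (by decide) (by decide) (by decide), h12]
    have e₃ : τ₂ 3 0 = q := by
      rw [h₂.2 3 (by decide), f 3 (by decide) (by decide) (by decide) (by decide), h3]
    have e₈ : τ₂ 8 0 = k := by rw [h₂.2 8 (by decide), h8]
    have e₁₁ : τ₂ 11 0 = τ' 11 0 := by rw [h₂.2 11 (by decide)]
    refine Halts.mono (Halts.ite (K₁ := 11) (K₂ := 1) hτ₂ (fun hne => ?_) (fun heq => ?_)) ?_
      (fun _ _ h => h)
    · simp only [Expr.eval, e₁₂, e₃, h₂.1] at hne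
      have hle : q * shiftCost q m b i (σ 13) (σ 14) k ≤ totalWeight q b (σ 13) := by omega
      refine Halts.mono (Halts.set hτ₂ (v := k) e₈ (hk.trans hqS)) le_rfl fun τ₃ _ h₃ => ?_
      rw [h₃.1]
      exact ⟨hk, fun _ _ _ => hle⟩
    · simp only [Expr.eval, e₁₂, e₃, h₂.1] at heq
      refine Halts.skip hτ₂ ⟨by rw [e₁₁]; exact hI.1, fun u hu hle => ?_⟩
      rcases Nat.lt_succ_iff_lt_or_eq.1 hu with h' | rfl
      · rw [e₁₁]; exact hI.2 u h' hle
      · omega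
    · simp [Expr.weight]
  · simp only [Expr.weight]; nlinarith
  · rintro τ' - ⟨h₁, h₂⟩
    obtain ⟨u, hu, hle⟩ := exists_shiftCost_le (W := σ 13) hq hU
    exact ⟨h₁, h₂ u hu hle⟩

/-- Doubles the weights of the cells selected by the shift in variable `11`. -/
def updateProg : Prog :=
  .forLoop 9 (.var 6) (.seq (.set 18 (slotExpr 11))
    (.seq (.set 12 (.add (.var 12) (.read 13 (.var 18))))
      (.assign 13 (.var 18) (.mul (.const 2) (.read 13 (.var 18))))))

theorem updateProg_halts {S q m b i u : ℕ} {σ : Store} (hσ : Mem S σ) (hq : 0 < q)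
    (h3 : σ 3 0 = q) (h4 : σ 4 0 = m) (h6 : σ 6 0 = b) (h7 : σ 7 0 = i) (h11 : σ 11 0 = u)
    (h12 : σ 12 0 = totalWeight q b (σ 13)) (hbS : b * q < 2 ^ S)
    (hS : 2 * totalWeight q b (σ 13) < 2 ^ S) :
    Halts S ((b + 1) * 6000) updateProg σ
      (fun τ => τ 12 0 = totalWeight q b (τ 13) ∧
        totalWeight q b (τ 13) = totalWeight q b (σ 13) + shiftCost q m b i (σ 13) (σ 14) u ∧
        ∀ c < b, ∀ d < q, τ 13 (c * q + d) =
          if d = (u + q - σ 14 (c * m + i)) % q then 2 * σ 13 (c * q + d)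
          else σ 13 (c * q + d)) := by
  have hS0 : 0 < 2 ^ S := by positivity
  refine Halts.mono (Halts.forLoop
      (I := fun k τ => τ 12 0 = totalWeight q b (σ 13) + shiftCost q m k i (σ 13) (σ 14) u ∧
        ∀ c < b, ∀ d < q, τ 13 (c * q + d) =
          if c < k ∧ d = (u + q - σ 14 (c * m + i)) % q then 2 * σ 13 (c * q + d)
          else σ 13 (c * q + d)) (n₀ := b) hσ
      (h6 ▸ hσ 6 0) (by decide) ?_ ?_ ?_ ?_ (K := 5000)) ?_ ?_
  · intro τ' hτ'
    simp only [Expr.eval]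
    rw [hτ' 6 (by decide) (by decide), h6]
  · intro k τ x hk
    rwa [Store.write_of_ne (by decide), Store.write_of_ne (by decide)]
  · simp [h12, shiftCost]
  · intro k τ hk hτ hI h9 hfr
    have f : ∀ y, y ≠ 9 → y ≠ 12 → y ≠ 13 → y ≠ 18 → τ y = σ y := fun y h1 h2 h3 h4 =>
      hfr y h1 (by simp [Prog.writes, *])
    set D := (u + q - σ 14 (k * m + i)) % q with hD
    have hDq : D < q := Nat.mod_lt _ hq
    have hslot : (slotExpr 11).eval τ = k * q + D := by
      simp only [Expr.eval, slotExpr, h9, f 3 (by decide) (by decide) (by decide) (by decide),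
        f 4 (by decide) (by decide) (by decide) (by decide),
        f 7 (by decide) (by decide) (by decide) (by decide),
        f 11 (by decide) (by decide) (by decide) (by decide),
        f 14 (by decide) (by decide) (by decide) (by decide), h3, h4, h7, h11, hD]
    have hlt : k * q + D < 2 ^ S := by
      have : (k + 1) * q ≤ b * q := Nat.mul_le_mul_right _ hk
      have h' : (k + 1) * q = k * q + q := by ring
      omega
    have hW : τ 13 (k * q + D) = σ 13 (k * q + D) := by
      rw [hI.2 k hk D hDq, if_neg (by omega)]
    have hWle : σ 13 (k * q + D) ≤ totalWeight q b (σ 13) := le_totalWeight _ hk hDq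
    have hcost : shiftCost q m (k + 1) i (σ 13) (σ 14) u =
        shiftCost q m k i (σ 13) (σ 14) u + σ 13 (k * q + D) := by
      rw [shiftCost, shiftCost, sum_range_succ]
    have hcle := shiftCost_le (m := m) (i := i) (W := σ 13) (U := σ 14) hq u
      (show k + 1 ≤ b from hk)
    refine Halts.mono (Halts.seq (Halts.set hτ hslot hlt) fun τ₁ hτ₁ h₁ => Halts.seq
      (Halts.set hτ₁ (v := totalWeight q b (σ 13) + shiftCost q m (k + 1) i (σ 13) (σ 14) u)
        ?_ ?_)
      fun τ₂ hτ₂ h₂ => Halts.assign hτ₂ ?_ ⟨?_, ?_⟩) ?_ (fun _ _ h => h)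
    · simp only [Expr.eval, h₁.1, h₁.2 12 (by decide), h₁.2 13 (by decide), hI.1, hW]; omega
    · omega
    · simp only [Expr.eval, h₂.2 18 (by decide), h₂.2 13 (by decide), h₁.1,
        h₁.2 13 (by decide), hW]; omega
    · simp [Expr.weight, slotExpr]
    · rw [Store.write_of_ne (by decide), h₂.1]
    · intro c hc d hd
      rw [Store.write_self]
      simp only [Expr.eval, h₂.2 18 (by decide), h₂.2 13 (by decide), h₁.1,
        h₁.2 13 (by decide), hW]
      by_cases hcd : c = k ∧ d = D
      · obtain ⟨rfl, rfl⟩ := hcd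
        rw [Function.update_self, if_pos ⟨by omega, hD⟩]
      · have hne : c * q + d ≠ k * q + D := fun h => hcd (block_index_inj hd hDq h)
        rw [Function.update_of_ne hne, hI.2 c hc d hd]
        by_cases hck : c = k
        · subst hck
          rw [if_neg (by omega), if_neg (fun h => hcd ⟨rfl, h.2⟩)]
        · have : c < k + 1 ↔ c < k := by omega
          simp only [this]
  · simp only [Expr.weight]; omega
  · rintro τ - ⟨h₁, h₂⟩
    have h₃ : ∀ c < b, ∀ d < q, τ 13 (c * q + d) =
          if d = (u + q - σ 14 (c * m + i)) % q then 2 * σ 13 (c * q + d)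
          else σ 13 (c * q + d) := by
      intro c hc d hd
      rw [h₂ c hc d hd]
      simp only [hc, true_and]
    have h₄ := totalWeight_double hq h₃
    exact ⟨h₁.trans h₄.symm, h₄, h₃⟩

end Ram

/-! ### The greedy invariant -/

/-- The shifts of the first `b` blocks are residues modulo `q`, and any two of these blocks differ
by the same residue in few of the `m` rows. -/
def Separated (q m b : ℕ) (U : ℕ → ℕ) : Prop :=
  (∀ c < b, ∀ i < m, U (c * m + i) < q) ∧
    ∀ b' < b, ∀ c < b', ∀ d < q, 2 ^ hits q m U b' c d m * q ^ m ≤ b' * q * (q + 1) ^ m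

/-- The state of the greedy choice of the shifts of block `b` after `i` rows: the weight of the cell
`c * q + d` is `2` to the number of rows so far in which the blocks `b` and `c` differ by `d`, and
the total weight `tot` grew by a factor of at most `1 + 1 / q` in every row. -/
structure RowInv (q m b i tot : ℕ) (W U : ℕ → ℕ) : Prop where
  sep : Separated q m b U
  tot_eq : tot = totalWeight q b W
  tot_le : tot * q ^ i ≤ b * q * (q + 1) ^ i
  weight : ∀ c < b, ∀ d < q, W (c * q + d) = 2 ^ hits q m U b c d i
  cur : ∀ i' < i, U (b * m + i') < q

theorem hits_congr {q m b c d k : ℕ} {U U' : ℕ → ℕ} (hb : ∀ i < k, U' (b * m + i) = U (b * m + i))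
    (hc : ∀ i < k, U' (c * m + i) = U (c * m + i)) : hits q m U' b c d k = hits q m U b c d k := by
  unfold hits
  congr 1
  refine filter_congr fun i hi => ?_
  rw [hb i (mem_range.1 hi), hc i (mem_range.1 hi)]

theorem hits_succ (q m : ℕ) (U : ℕ → ℕ) (b c d k : ℕ) : hits q m U b c d (k + 1) =
    hits q m U b c d k + if (U (b * m + k) + q - U (c * m + k)) % q = d then 1 else 0 := by
  unfold hits
  rw [range_add_one, filter_insert]
  split_ifs
  · rw [card_insert_of_notMem (by simp)]
  · rfl

theorem hits_le (q m : ℕ) (U : ℕ → ℕ) (b c d k : ℕ) : hits q m U b c d k ≤ k :=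
  (card_filter_le _ _).trans (card_range k).le

theorem Separated.congr {q m b : ℕ} {U U' : ℕ → ℕ} (h : Separated q m b U)
    (hU : ∀ c < b, ∀ i < m, U' (c * m + i) = U (c * m + i)) : Separated q m b U' := by
  refine ⟨fun c hc i hi => by rw [hU c hc i hi]; exact h.1 c hc i hi, fun b' hb' c hc d hd => ?_⟩
  rw [hits_congr (hU b' hb') (hU c (hc.trans hb'))]
  exact h.2 b' hb' c hc d hd

theorem totalWeight_le {q b w : ℕ} {W : ℕ → ℕ} (h : ∀ c < b, ∀ d < q, W (c * q + d) ≤ w) :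
    totalWeight q b W ≤ b * q * w := by
  have h₁ : ∀ c ∈ range b, ∑ d ∈ range q, W (c * q + d) ≤ q * w := fun c hc => by
    simpa using sum_le_card_nsmul (range q) _ w fun d hd => h c (mem_range.1 hc) d (mem_range.1 hd)
  have h₂ := sum_le_card_nsmul (range b) _ _ h₁
  rw [card_range, smul_eq_mul, ← mul_assoc] at h₂
  exact h₂

namespace RowInv

variable {q m b i tot : ℕ} {W U : ℕ → ℕ}

theorem tot_le_two_pow (h : RowInv q m b i tot W U) (hi : i ≤ m) : tot ≤ b * q * 2 ^ m := by
  rw [h.tot_eq]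
  refine totalWeight_le fun c hc d hd => ?_
  rw [h.weight c hc d hd]
  exact Nat.pow_le_pow_right (by norm_num) ((hits_le ..).trans hi)

theorem start (hsep : Separated q m b U) (hW : ∀ k < b * q, W k = 1) :
    RowInv q m b 0 (b * q) W U := by
  have h : ∀ c < b, ∀ d < q, W (c * q + d) = 1 := fun c hc d hd => hW _ (by
    have := Nat.mul_le_mul_right q (Nat.succ_le_of_lt hc)
    rw [Nat.succ_mul] at this
    omega)
  refine ⟨hsep, ?_, by simp, fun c hc d hd => ?_, fun i' hi' => absurd hi' (by omega)⟩
  · unfold totalWeight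
    rw [sum_congr rfl fun c hc => sum_congr rfl fun d hd =>
      h c (mem_range.1 hc) d (mem_range.1 hd)]
    simp
  · rw [h c hc d hd]
    simp [hits]

theorem step (h : RowInv q m b i tot W U) (hi : i < m) {u tot' : ℕ} {W' : ℕ → ℕ}
    (hu : u < q) (hcost : q * shiftCost q m b i W U u ≤ totalWeight q b W)
    (htot : tot' = totalWeight q b W')
    (htot' : totalWeight q b W' = totalWeight q b W + shiftCost q m b i W U u)
    (hW : ∀ c < b, ∀ d < q, W' (c * q + d) =
      if d = (u + q - U (c * m + i)) % q then 2 * W (c * q + d) else W (c * q + d)) :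
    RowInv q m b (i + 1) tot' W' (Function.update U (b * m + i) u) := by
  have hold : ∀ c < b, ∀ i' < m,
      Function.update U (b * m + i) u (c * m + i') = U (c * m + i') := fun c hc i' hi' =>
    Function.update_of_ne (fun e => by have := (block_index_inj hi' hi e).1; omega) _ _
  have hcur : ∀ i' < i, Function.update U (b * m + i) u (b * m + i') = U (b * m + i') :=
    fun i' hi' => Function.update_of_ne (by omega) _ _
  refine ⟨h.sep.congr hold, htot, ?_, fun c hc d hd => ?_, fun i' hi' => ?_⟩
  · have h₁ : q * tot' ≤ (q + 1) * tot := by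
      rw [htot, htot', h.tot_eq]
      linarith
    calc tot' * q ^ (i + 1) = q * tot' * q ^ i := by ring
      _ ≤ (q + 1) * tot * q ^ i := Nat.mul_le_mul_right _ h₁
      _ = (q + 1) * (tot * q ^ i) := by ring
      _ ≤ (q + 1) * (b * q * (q + 1) ^ i) := Nat.mul_le_mul_left _ h.tot_le
      _ = b * q * (q + 1) ^ (i + 1) := by ring
  · rw [hW c hc d hd, hits_succ, hits_congr hcur (fun i' hi' => hold c hc i' (hi'.trans hi)),
      hold c hc i hi, Function.update_self, h.weight c hc d hd]
    by_cases hd' : d = (u + q - U (c * m + i)) % q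
    · rw [if_pos hd', if_pos hd'.symm, pow_succ, mul_comm]
    · rw [if_neg hd', if_neg (Ne.symm hd'), add_zero]
  · rcases Nat.lt_succ_iff_lt_or_eq.1 hi' with hi' | rfl
    · rw [hcur i' hi']; exact h.cur i' hi'
    · rwa [Function.update_self]

theorem finish (h : RowInv q m b m tot W U) : Separated q m (b + 1) U := by
  refine ⟨fun c hc i hi => ?_, fun b' hb' c hc d hd => ?_⟩
  · rcases Nat.lt_succ_iff_lt_or_eq.1 hc with hc | rfl
    · exact h.sep.1 c hc i hi
    · exact h.cur i hi
  · rcases Nat.lt_succ_iff_lt_or_eq.1 hb' with hb' | rfl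
    · exact h.sep.2 b' hb' c hc d hd
    · refine le_trans (Nat.mul_le_mul_right _ ?_) h.tot_le
      rw [← h.weight c hc d hd, h.tot_eq]
      exact le_totalWeight _ hc hd

end RowInv

/-! ### Programs for the whole code and for the output -/

namespace Ram

/-- Chooses the shift of the current block in the current row and updates the weights. -/
def rowProg : Prog :=
  .seq searchProg (.seq updateProg
    (.assign 14 (.add (.mul (.var 6) (.var 4)) (.var 7)) (.var 11)))

theorem rowProg_halts {S q m b i : ℕ} {σ : Store} (hσ : Mem S σ) (hq : 0 < q)
    (h3 : σ 3 0 = q) (h4 : σ 4 0 = m) (h6 : σ 6 0 = b) (h7 : σ 7 0 = i) (hi : i < m)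
    (hS : 2 * (b * q * 2 ^ m) < 2 ^ S) (h : RowInv q m b i (σ 12 0) (σ 13) (σ 14)) :
    Halts S ((q + 1) * ((b + 1) * 20000)) rowProg σ
      (fun τ => RowInv q m b (i + 1) (τ 12 0) (τ 13) (τ 14)) := by
  have htot := h.tot_le_two_pow hi.le
  have hbq : b * q ≤ b * q * 2 ^ m := Nat.le_mul_of_pos_right _ (by positivity)
  refine Halts.mono (Halts.seq (searchProg_halts hσ hq h3 h4 h6 h7 h.tot_eq
    fun c hc => h.sep.1 c hc i hi).frame fun τ₁ hτ₁ h₁ => Halts.seq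
    (updateProg_halts (q := q) (m := m) (b := b) (i := i) (u := τ₁ 11 0) hτ₁ hq ?_ ?_ ?_ ?_ rfl
      ?_ (by omega) ?_).frame
    fun τ₂ hτ₂ h₂ => Halts.assign hτ₂ (hτ₂ 11 0) ?_) ?_ (fun _ _ h => h)
  · rw [h₁.2 3 (by decide), h3]
  · rw [h₁.2 4 (by decide), h4]
  · rw [h₁.2 6 (by decide), h6]
  · rw [h₁.2 7 (by decide), h7]
  · rw [h₁.2 12 (by decide), h₁.2 13 (by decide), h.tot_eq]
  · rw [h₁.2 13 (by decide), ← h.tot_eq]; omega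
  · obtain ⟨⟨ha, hb, hc⟩, hfr⟩ := h₂
    rw [h₁.2 13 (by decide), h₁.2 14 (by decide)] at hb hc
    rw [Store.write_of_ne (by decide), Store.write_of_ne (by decide), Store.write_self]
    have hidx : (Expr.add (.mul (.var 6) (.var 4)) (.var 7)).eval τ₂ = b * m + i := by
      simp only [Expr.eval]
      rw [hfr 6 (by decide), hfr 4 (by decide), hfr 7 (by decide), h₁.2 6 (by decide),
        h₁.2 4 (by decide), h₁.2 7 (by decide), h6, h4, h7]
    have hval : (Expr.var 11).eval τ₂ = τ₁ 11 0 := by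
      simp only [Expr.eval]
      rw [hfr 11 (by decide)]
    rw [hidx, hval, hfr 14 (by decide), h₁.2 14 (by decide)]
    exact h.step hi h₁.1.1 h₁.1.2 ha hb hc
  · simp only [Expr.weight]
    nlinarith [Nat.zero_le (q * b)]

/-- Chooses the shifts of the current block. -/
def blockProg : Prog :=
  .seq (.forLoop 16 (.mul (.var 6) (.var 3)) (.assign 13 (.var 16) (.const 1)))
    (.seq (.set 12 (.mul (.var 6) (.var 3))) (.forLoop 7 (.var 4) rowProg))

theorem blockProg_halts {S q m b : ℕ} {σ : Store} (hσ : Mem S σ) (hq : 0 < q)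
    (h3 : σ 3 0 = q) (h4 : σ 4 0 = m) (h6 : σ 6 0 = b)
    (hS : 2 * (b * q * 2 ^ m) + 1 < 2 ^ S) (h : Separated q m b (σ 14)) :
    Halts S ((m + 2) * ((q + 1) * ((b + 1) * 30000))) blockProg σ
      (fun τ => Separated q m (b + 1) (τ 14)) := by
  have hbq : b * q ≤ b * q * 2 ^ m := Nat.le_mul_of_pos_right _ (by positivity)
  refine Halts.mono (Halts.seq (Halts.forLoop (I := fun k τ => ∀ j < k, τ 13 j = 1)
    (n₀ := b * q) (K := 20) hσ (by omega) (by decide) ?_ ?_ ?_ ?_).frame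
    fun τ₁ hτ₁ h₁ => Halts.seq (Halts.set (v := b * q) hτ₁ ?_ (by omega))
    fun τ₂ hτ₂ h₂ => Halts.forLoop
      (I := fun k τ => RowInv q m b k (τ 12 0) (τ 13) (τ 14))
      (n₀ := m) (K := (q + 1) * ((b + 1) * 20000)) hτ₂ ?_ (by decide) ?_ ?_ ?_ ?_) ?_
    (fun τ _ hτ => hτ.finish)
  · intro τ hτ
    simp only [Expr.eval]
    rw [hτ 6 (by decide) (by decide), hτ 3 (by decide) (by decide), h3, h6]
  · intro k τ x hk
    rwa [Store.write_of_ne (by decide)]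
  · intro j hj; omega
  · intro k τ hk hτ hI h16 hfr
    refine Halts.mono (Halts.assign (Q := fun τ => ∀ j < k + 1, τ 13 j = 1) hτ (by
      simp only [Expr.eval]; omega) ?_) ?_ (fun _ _ h => h)
    · intro j hj
      rw [Store.write_self]
      simp only [Expr.eval, h16]
      rcases Nat.lt_succ_iff_lt_or_eq.1 hj with hj | rfl
      · rw [Function.update_of_ne (by omega), hI j hj]
      · rw [Function.update_self]
    · simp [Expr.weight]
  · simp only [Expr.eval]
    rw [h₁.2 6 (by decide), h₁.2 3 (by decide), h3, h6]
  · rw [← h4]; exact hσ 4 0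
  · intro τ hτ
    simp only [Expr.eval]
    rw [hτ 4 (by decide) (by decide), h₂.2 4 (by decide), h₁.2 4 (by decide), h4]
  · intro k τ x hk
    rwa [Store.write_of_ne (by decide), Store.write_of_ne (by decide),
      Store.write_of_ne (by decide)]
  · rw [h₂.1, h₂.2 13 (by decide), h₂.2 14 (by decide), h₁.2 14 (by decide)]
    exact .start h h₁.1
  · intro k τ hk hτ hI h7 hfr
    refine rowProg_halts hτ hq ?_ ?_ ?_ h7 hk (by omega) hI
    · rw [hfr 3 (by decide) (by decide), h₂.2 3 (by decide), h₁.2 3 (by decide), h3]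
    · rw [hfr 4 (by decide) (by decide), h₂.2 4 (by decide), h₁.2 4 (by decide), h4]
    · rw [hfr 6 (by decide) (by decide), h₂.2 6 (by decide), h₁.2 6 (by decide), h6]
  · simp only [Expr.weight]
    have h₁ : (b * q + 1) ≤ (q + 1) * (b + 1) := by nlinarith
    have h₂ : 1 ≤ (q + 1) * (b + 1) := Nat.succ_le_of_lt (by positivity)
    generalize hx : (q + 1) * (b + 1) = x at h₁ h₂
    have e₁ : (q + 1) * ((b + 1) * 20000) = 20000 * x := by rw [← hx]; ring
    have e₂ : (q + 1) * ((b + 1) * 30000) = 30000 * x := by rw [← hx]; ring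
    rw [e₁, e₂]
    nlinarith [Nat.zero_le (m * x)]

/-- Chooses the shifts of all blocks. -/
def codeProg : Prog :=
  .forLoop 6 (.add (.div (.read 0 (.const 0)) (.var 3)) (.const 1)) blockProg

theorem codeProg_halts {S q m N : ℕ} {σ : Store} (hσ : Mem S σ) (hq : 0 < q)
    (h0 : σ 0 0 = N) (h3 : σ 3 0 = q) (h4 : σ 4 0 = m) (hS : 2 * (N * 2 ^ m) + 1 < 2 ^ S) :
    Halts S ((N + 2) * ((m + 2) * ((q + 1) * ((N + 1) * 40000)))) codeProg σ
      (fun τ => Separated q m (N / q + 1) (τ 14)) := by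
  have hN : N ≤ N * 2 ^ m := Nat.le_mul_of_pos_right _ (by positivity)
  have hNq : N / q ≤ N := Nat.div_le_self _ _
  refine Halts.mono (Halts.forLoop (I := fun b τ => Separated q m b (τ 14))
    (n₀ := N / q + 1) (K := (m + 2) * ((q + 1) * ((N + 1) * 30000))) hσ (by omega) (by decide)
    ?_ ?_ ?_ ?_) ?_ (fun _ _ h => h)
  · intro τ hτ
    simp only [Expr.eval]
    rw [hτ 0 (by decide) (by decide), hτ 3 (by decide) (by decide), h0, h3]
  · intro k τ x hk
    rwa [Store.write_of_ne (by decide)]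
  · exact ⟨fun c hc => absurd hc (by omega), fun c hc => absurd hc (by omega)⟩
  · intro b τ hb hτ hI h6 hfr
    have hbN : b * q ≤ N := (Nat.mul_le_mul_right q (Nat.le_of_lt_succ hb)).trans
      (Nat.div_mul_le_self N q)
    have hb' : b * q * 2 ^ m ≤ N * 2 ^ m := Nat.mul_le_mul_right _ hbN
    refine Halts.mono (blockProg_halts hτ hq ?_ ?_ h6 (by omega) hI) ?_ (fun _ _ h => h)
    · rw [hfr 3 (by decide) (by decide), h3]
    · rw [hfr 4 (by decide) (by decide), h4]
    · gcongr
      omega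
  · have h₁ : 1 ≤ (m + 2) * ((q + 1) * (N + 1)) := Nat.succ_le_of_lt (by positivity)
    have e₁ : (m + 2) * ((q + 1) * ((N + 1) * 30000)) =
      30000 * ((m + 2) * ((q + 1) * (N + 1))) := by ring
    have e₂ : (m + 2) * ((q + 1) * ((N + 1) * 40000)) =
      40000 * ((m + 2) * ((q + 1) * (N + 1))) := by ring
    rw [e₁, e₂]
    refine Nat.mul_le_mul (by omega) ?_
    simp only [Expr.weight]
    omega

/-- The cell of the entry in which the column stored in variable `17` has its `1` among the `q` rows
that belong to the row of the code stored in variable `7`. -/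
def entryExpr : Expr :=
  .add (.mul (.add (.mul (.var 7) (.var 3)) (.mod (.add (.var 17) (.read 14
    (.add (.mul (.div (.var 17) (.var 3)) (.var 4)) (.var 7)))) (.var 3))) (.read 0 (.const 0)))
    (.var 17)

/-- Outputs the matrix. -/
def outputProg : Prog :=
  .seq (.set 1 (.mul (.var 3) (.var 4)))
    (.forLoop 17 (.read 0 (.const 0)) (.forLoop 7 (.var 4) (.assign 2 entryExpr (.const 1))))

theorem outputProg_halts {S q m N : ℕ} {σ : Store} (hσ : Mem S σ) (hq : 0 < q)
    (h0 : σ 0 0 = N) (h2 : ∀ k, σ 2 k = 0) (h3 : σ 3 0 = q) (h4 : σ 4 0 = m)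
    (hS : q * m < 2 ^ S) (hS1 : 1 < 2 ^ S) :
    Halts S ((N + 2) * ((m + 1) * 20000)) outputProg σ
      (fun τ => τ 1 0 = q * m ∧ ∀ r < q * m, ∀ j < N, τ 2 (r * N + j) =
        if (j + σ 14 (j / q * m + r / q)) % q = r % q then 1 else 0) := by
  set U := σ 14 with hU
  refine Halts.mono (Halts.seq (Halts.set (v := q * m) hσ ?_ hS) fun τ₁ hτ₁ h₁ =>
    Halts.mono (Halts.frame (Halts.forLoop (I := fun k τ => ∀ r, ∀ j < N, τ 2 (r * N + j) =
      if (j < k ∧ r < q * m) ∧ (j + U (j / q * m + r / q)) % q = r % q then 1 else 0)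
    (n₀ := N) (K := (m + 1) * 18000) hτ₁ ?_ (by decide) ?_ ?_ ?_ ?_)) le_rfl ?_) ?_ (fun _ _ h => h)
  · simp only [Expr.eval]
    rw [h3, h4]
  · rw [← h0]; exact hσ 0 0
  · intro τ hτ
    simp only [Expr.eval]
    rw [hτ 0 (by decide) (by decide), h₁.2 0 (by decide), h0]
  · intro k τ x hk
    rwa [Store.write_of_ne (by decide)]
  · intro r j hj
    rw [h₁.2 2 (by decide), h2, if_neg (by omega)]
  · intro k τ hk hτ hI h17 hfr
    have f : ∀ y, y ≠ 1 → y ≠ 2 → y ≠ 7 → y ≠ 17 → τ y = σ y := fun y h h' h'' h''' => by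
      rw [hfr y h''' (by simp [Prog.writes, Prog.forLoop, *]), h₁.2 y h]
    refine Halts.mono (Halts.forLoop (I := fun i τ => ∀ r, ∀ j < N, τ 2 (r * N + j) =
      if ((j < k ∧ r < q * m) ∨ (j = k ∧ r < i * q)) ∧
        (j + U (j / q * m + r / q)) % q = r % q then 1 else 0) (n₀ := m) (K := 16000) hτ
      ?_ (by decide) ?_ ?_ ?_ ?_) ?_ ?_
    · rw [← h4]; exact hσ 4 0
    · intro τ' hτ'
      simp only [Expr.eval]
      rw [hτ' 4 (by decide) (by decide), f 4 (by decide) (by decide) (by decide) (by decide), h4]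
    · intro i τ' x h
      rwa [Store.write_of_ne (by decide)]
    · intro r j hj
      rw [hI r j hj]
      simp
    · intro i τ' hi hτ' hI' h7 hfr'
      have g : ∀ y, y ≠ 1 → y ≠ 2 → y ≠ 7 → y ≠ 17 → τ' y = σ y := fun y h h' h'' h''' => by
        rw [hfr' y h'' (by simp [Prog.writes, *]), f y h h' h'' h''']
      set s := (k + U (k / q * m + i)) % q with hs
      have hsq : s < q := Nat.mod_lt _ hq
      have hidx : entryExpr.eval τ' = (i * q + s) * N + k := by
        simp only [entryExpr, Expr.eval]
        rw [g 0 (by decide) (by decide) (by decide) (by decide),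
          g 3 (by decide) (by decide) (by decide) (by decide),
          g 4 (by decide) (by decide) (by decide) (by decide),
          g 14 (by decide) (by decide) (by decide) (by decide), hfr' 17 (by decide) (by decide),
          h0, h3, h4, h7, h17]
      refine Halts.mono (Halts.assign (Q := fun τ => ∀ r, ∀ j < N, τ 2 (r * N + j) =
        if ((j < k ∧ r < q * m) ∨ (j = k ∧ r < (i + 1) * q)) ∧
          (j + U (j / q * m + r / q)) % q = r % q then 1 else 0) hτ' hS1 ?_) ?_ (fun _ _ h => h)
      · intro r j hj
        rw [Store.write_self, hidx]
        simp only [Expr.eval]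
        by_cases hrj : r = i * q + s ∧ j = k
        · obtain ⟨rfl, rfl⟩ := hrj
          have e₁ : (i * q + s) / q = i := by
            rw [mul_comm, Nat.mul_add_div hq, Nat.div_eq_of_lt hsq, add_zero]
          have e₂ : (i * q + s) % q = s := by
            rw [mul_comm, Nat.mul_add_mod, Nat.mod_eq_of_lt hsq]
          rw [Function.update_self, if_pos]
          refine ⟨Or.inr ⟨rfl, ?_⟩, by rw [e₁, e₂]⟩
          rw [Nat.succ_mul]; omega
        · have hne : r * N + j ≠ (i * q + s) * N + k := fun h => hrj (block_index_inj hj hk h)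
          rw [Function.update_of_ne hne, hI' r j hj]
          refine if_congr ?_ rfl rfl
          constructor
          · rintro ⟨h | ⟨h, h'⟩, h''⟩
            · exact ⟨Or.inl h, h''⟩
            · exact ⟨Or.inr ⟨h, by rw [Nat.succ_mul]; omega⟩, h''⟩
          · rintro ⟨h | ⟨rfl, h'⟩, h''⟩
            · exact ⟨Or.inl h, h''⟩
            · refine ⟨Or.inr ⟨rfl, ?_⟩, h''⟩
              by_contra hlt
              have hri : r / q = i :=
                le_antisymm (Nat.le_of_lt_succ ((Nat.div_lt_iff_lt_mul hq).2 h'))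
                  ((Nat.le_div_iff_mul_le hq).2 (by omega))
              rw [hri] at h''
              refine hrj ⟨?_, rfl⟩
              rw [hs, h'', ← hri, mul_comm, Nat.div_add_mod]
      · simp [Expr.weight, entryExpr]
    · simp only [Expr.weight]; omega
    · intro τ' _ h r j hj
      rw [h r j hj]
      refine if_congr ?_ rfl rfl
      rw [mul_comm m q]
      refine and_congr_left fun _ => ?_
      constructor
      · rintro (h | h) <;> omega
      · intro h
        rcases Nat.lt_succ_iff_lt_or_eq.1 h.1 with h' | h'
        · exact Or.inl ⟨h', h.2⟩
        · exact Or.inr ⟨h', h.2⟩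
  · rintro τ - ⟨h, hfr⟩
    refine ⟨by rw [hfr 1 (by decide), h₁.1], fun r hr j hj => ?_⟩
    rw [h r j hj]
    simp only [hj, hr, true_and]
  · simp only [Expr.weight]
    nlinarith [Nat.zero_le (N * m)]

end Ram

/-! ### The algorithm and its parameters -/

namespace Ram

/-- The integer part of `2 * (t + 1) / e` for `e = num / den`. -/
def ratioExpr : Expr :=
  .div (.mul (.const 2) (.mul (.add (.read 0 (.const 1)) (.const 1)) (.read 0 (.const 3))))
    (.read 0 (.const 2))

/-- The whole algorithm: it computes the parameters `q = 4 (t + l + 1)` and `m = 4 (l + 1) (lN + 1)`,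
where `l` and `lN` are the binary logarithms of `2 (t + 1) / e` and of `N`, chooses the shifts and
outputs the matrix. -/
def constructProg : Prog :=
  .seq (logProg 15 5 ratioExpr) (.seq (logProg 15 19 (.read 0 (.const 0)))
    (.seq (.set 3 (.mul (.const 4) (.add (.add (.read 0 (.const 1)) (.var 5)) (.const 1))))
      (.seq (.set 4 (.mul (.mul (.const 4) (.add (.var 5) (.const 1)))
        (.add (.var 19) (.const 1)))) (.seq codeProg outputProg))))

theorem ratio_lt (t num den : ℕ) : 2 * ((t + 1) * den) / num < 2 ^ (t + den.size + 1) := by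
  refine (Nat.div_le_self _ _).trans_lt ?_
  have h₁ : t + 1 ≤ 2 ^ t := Nat.lt_two_pow_self
  have h₂ := Nat.lt_size_self den
  calc 2 * ((t + 1) * den) ≤ 2 * (2 ^ t * den) := by gcongr
    _ < 2 * (2 ^ t * 2 ^ den.size) := by gcongr
    _ = 2 ^ (t + den.size + 1) := by ring

/-- The parameters of the code and the memory it needs are polynomial in the length of the input. -/
theorem parameters_le {N t num den n l lN q m S : ℕ} (hN : 1 ≤ N)
    (hn : n = N + t + num.size + den.size)
    (hl : l = Nat.log 2 (2 * ((t + 1) * den) / num)) (hlN : lN = Nat.log 2 N)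
    (hq : q = 4 * (t + l + 1)) (hm : m = 4 * (l + 1) * (lN + 1)) (hS : S = 20 * (n + 1) ^ 2) :
    l ≤ n ∧ lN ≤ n ∧ q ≤ 8 * (n + 1) ∧ m ≤ 4 * (n + 1) ^ 2 ∧ n + q + m + 5 ≤ S := by
  have hl' : l ≤ n := by
    have h : 2 * ((t + 1) * den) / num < 2 ^ (n + 1) :=
      (ratio_lt t num den).trans_le (Nat.pow_le_pow_right (by norm_num) (by omega))
    rw [hl]
    exact Nat.lt_succ_iff.1 (Nat.log_lt_of_lt_pow' (by omega) h)
  have hlN' : lN ≤ n := by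
    rw [hlN]
    exact (Nat.log_le_self 2 N).trans (by omega)
  have hq' : q ≤ 8 * (n + 1) := by omega
  have hm' : m ≤ 4 * (n + 1) ^ 2 := by
    rw [hm, pow_two, ← mul_assoc]
    gcongr
  refine ⟨hl', hlN', hq', hm', ?_⟩
  rw [hS]
  have : 1 ≤ n := by omega
  nlinarith

theorem constructProg_halts {N t num den n l lN q m S : ℕ} (hN : 1 ≤ N)
    (hn : n = N + t + num.size + den.size)
    (hl : l = Nat.log 2 (2 * ((t + 1) * den) / num)) (hlN : lN = Nat.log 2 N)
    (hq : q = 4 * (t + l + 1)) (hm : m = 4 * (l + 1) * (lN + 1)) (hS : S = 20 * (n + 1) ^ 2) :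
    Halts S (10 ^ 7 * (n + 1) ^ 5) constructProg (Store.ofInput [N, t, num, den])
      (fun τ => ∃ U, Separated q m (N / q + 1) U ∧ τ 1 0 = q * m ∧
        ∀ r < q * m, ∀ j < N, τ 2 (r * N + j) =
          if (j + U (j / q * m + r / q)) % q = r % q then 1 else 0) := by
  obtain ⟨hl', hlN', hq', hm', hnS⟩ := parameters_le hN hn hl hlN hq hm hS
  have hq0 : 0 < q := by omega
  have pow_le : ∀ {k x : ℕ}, x < 2 ^ k → k ≤ S → x < 2 ^ S := fun h h' =>
    h.trans_le (Nat.pow_le_pow_right (by norm_num) h')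
  have hsmall : ∀ x ≤ S, x < 2 ^ S := fun x hx => pow_le Nat.lt_two_pow_self hx
  set σ := Store.ofInput [N, t, num, den] with hσdef
  have hσ : Mem S σ := by
    intro x i
    rw [hσdef, Store.ofInput]
    split_ifs
    · rcases i with - | - | - | - | i
      · exact hsmall N (by omega)
      · exact hsmall t (by omega)
      · exact pow_le (Nat.lt_size_self num) (by omega)
      · exact pow_le (Nat.lt_size_self den) (by omega)
      · simp
    · simp
  have hratio : ratioExpr.eval σ = 2 * ((t + 1) * den) / num := rfl
  have hratioS : 2 * ((t + 1) * den) / num < 2 ^ S :=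
    pow_le (ratio_lt t num den) (by omega)
  have hqm : q * m < 2 ^ S := by
    refine pow_le (k := q + m) ?_ (by omega)
    rw [pow_add]
    exact Nat.mul_lt_mul'' Nat.lt_two_pow_self Nat.lt_two_pow_self
  have hNm : 2 * (N * 2 ^ m) + 1 < 2 ^ S := by
    refine pow_le (k := n + m + 2) ?_ (by omega)
    have h₁ : N < 2 ^ n := (show N ≤ n by omega).trans_lt Nat.lt_two_pow_self
    have h₂ : N * 2 ^ m ≤ 2 ^ n * 2 ^ m := Nat.mul_le_mul_right _ h₁.le
    have h₃ : 0 < 2 ^ n * 2 ^ m := by positivity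
    have h₄ : 2 ^ (n + m + 2) = 4 * (2 ^ n * 2 ^ m) := by ring
    omega
  refine Halts.mono (Halts.seq (Halts.frame (logProg_halts (x := 15) (l := 5) (by decide) hσ hratio hratioS))
    fun τ₁ hτ₁ h₁ => Halts.seq (Halts.frame (logProg_halts (x := 15) (l := 19) (v := N)
      (by decide) hτ₁ (congrFun (h₁.2 0 (by decide)) 0) (hsmall N (by omega))))
    fun τ₂ hτ₂ h₂ => Halts.seq (Halts.set (v := q) hτ₂ ?_ (hsmall _ (by omega)))
    fun τ₃ hτ₃ h₃ => Halts.seq (Halts.set (v := m) hτ₃ ?_ (hsmall _ (by omega)))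
    fun τ₄ hτ₄ h₄ => Halts.seq
      (Halts.frame (codeProg_halts (q := q) (m := m) (N := N) hτ₄ hq0 ?_ ?_ h₄.1 hNm))
    fun τ₅ hτ₅ h₅ => Halts.mono (outputProg_halts (q := q) (m := m) (N := N) hτ₅ hq0
      ?_ ?_ ?_ ?_ hqm (hsmall 1 (by omega))) le_rfl fun τ _ hτ => ⟨_, h₅.1, hτ⟩) ?_
    (fun _ _ h => h)
  · simp only [Expr.eval]
    rw [h₂.2 0 (by decide), h₁.2 0 (by decide), h₂.2 5 (by decide), h₁.1, ← hl, hq]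
    rfl
  · simp only [Expr.eval]
    rw [h₃.2 5 (by decide), h₃.2 19 (by decide), h₂.2 5 (by decide), h₁.1, h₂.1, ← hl, ← hlN, hm]
  · rw [h₄.2 0 (by decide), h₃.2 0 (by decide), h₂.2 0 (by decide), h₁.2 0 (by decide)]
    rfl
  · rw [h₄.2 3 (by decide), h₃.1]
  · rw [h₅.2 0 (by decide), h₄.2 0 (by decide), h₃.2 0 (by decide), h₂.2 0 (by decide),
      h₁.2 0 (by decide)]
    rfl
  · intro k
    rw [h₅.2 2 (by decide), h₄.2 2 (by decide), h₃.2 2 (by decide), h₂.2 2 (by decide),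
      h₁.2 2 (by decide)]
    rfl
  · rw [h₅.2 3 (by decide), h₄.2 3 (by decide), h₃.1]
  · rw [h₅.2 4 (by decide), h₄.1]
  · rw [← hl, ← hlN]
    simp only [Expr.weight, ratioExpr]
    have hx : 1 ≤ n + 1 := by omega
    have hm1 : m + 2 ≤ 6 * (n + 1) ^ 2 := by nlinarith
    have hq1 : q + 1 ≤ 9 * (n + 1) := by omega
    have hN1 : N + 1 ≤ n + 1 := by omega
    have hN2 : N + 2 ≤ 2 * (n + 1) := by omega
    have e₁ : (N + 2) * ((m + 2) * ((q + 1) * ((N + 1) * 40000))) ≤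
        2 * (n + 1) * (6 * (n + 1) ^ 2 * (9 * (n + 1) * ((n + 1) * 40000))) := by gcongr
    have e₂ : (N + 2) * ((m + 1) * 20000) ≤ 2 * (n + 1) * (6 * (n + 1) ^ 2 * 20000) := by
      gcongr; omega
    have e₃ : (n + 1) ^ 3 ≤ (n + 1) ^ 5 := Nat.pow_le_pow_right hx (by norm_num)
    have e₄ : n + 1 ≤ (n + 1) ^ 5 := Nat.le_self_pow (by norm_num) _
    have e₅ : 2 * (n + 1) * (6 * (n + 1) ^ 2 * (9 * (n + 1) * ((n + 1) * 40000))) =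
        4320000 * (n + 1) ^ 5 := by ring
    have e₆ : 2 * (n + 1) * (6 * (n + 1) ^ 2 * 20000) = 240000 * (n + 1) ^ 3 := by ring
    omega

end Ram

/-! ### Sampling without replacement -/

/-- The inequality between the arithmetic and geometric means of `k` numbers `x ^ (k + 1)` and the
number `y ^ (k + 1)`. -/
theorem mul_pow_le_add_pow {x y : ℝ} (hx : 0 ≤ x) (hy : 0 ≤ y) (k : ℕ) :
    (k + 1) * (y * x ^ k) ≤ k * x ^ (k + 1) + y ^ (k + 1) := by
  induction k with
  | zero => simp
  | succ k ih =>
    have h₁ := mul_le_mul_of_nonneg_left ih hy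
    have h₂ : 0 ≤ (k + 1) * x ^ k * (y - x) ^ 2 := by positivity
    push_cast
    have e₁ : y * ((k + 1) * (y * x ^ k)) = (k + 1) * x ^ k * y ^ 2 := by ring
    have e₂ : y * (k * x ^ (k + 1) + y ^ (k + 1)) = k * x ^ (k + 1) * y + y ^ (k + 1 + 1) := by ring
    have e₃ : (k + 1) * x ^ k * (y - x) ^ 2 = (k + 1) * x ^ k * y ^ 2 -
      2 * (k + 1) * (y * x ^ (k + 1)) + (k + 1) * x ^ (k + 1 + 1) := by ring
    have e₄ : k * x ^ (k + 1) * y = k * (y * x ^ (k + 1)) := by ring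
    linarith

/-- Maclaurin's inequality between the elementary symmetric sum of degree `k` and the mean `M`. -/
theorem sum_powersetCard_prod_le {α : Type*} [DecidableEq α] (s : Finset α) (y : α → ℝ)
    (hy : ∀ a ∈ s, 0 ≤ y a) : ∀ (k : ℕ) (M : ℝ), ∑ a ∈ s, y a = #s * M →
      ∑ T ∈ powersetCard k s, ∏ a ∈ T, y a ≤ (#s).choose k * M ^ k := by
  induction s using Finset.induction_on with
  | empty =>
    rintro (- | k) M -
    · simp
    · rw [powersetCard_eq_empty.2 (by simp)]
      simp
  | insert a s ha ih =>
    rintro (- | k) M hM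
    · simp
    have hy' : ∀ b ∈ s, 0 ≤ y b := fun b hb => hy b (mem_insert_of_mem hb)
    have hya := hy a (mem_insert_self a s)
    obtain ⟨m, hm0, hm⟩ : ∃ m : ℝ, 0 ≤ m ∧ ∑ b ∈ s, y b = #s * m := by
      refine ⟨(∑ b ∈ s, y b) / #s, div_nonneg (sum_nonneg hy') (by positivity), ?_⟩
      rcases s.eq_empty_or_nonempty with rfl | hs
      · simp
      · rw [mul_div_cancel₀]
        exact_mod_cast hs.card_pos.ne'
    rw [sum_insert ha, hm, card_insert_of_notMem ha] at hM
    rw [card_insert_of_notMem ha]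
    set n := #s
    push_cast at hM
    have hM0 : 0 ≤ M := by
      have : 0 ≤ ((n : ℝ) + 1) * M := by rw [← hM]; positivity
      exact nonneg_of_mul_nonneg_right this (by positivity)
    have hsplit : ∑ T ∈ powersetCard (k + 1) (insert a s), ∏ b ∈ T, y b =
        ∑ T ∈ powersetCard (k + 1) s, ∏ b ∈ T, y b +
          y a * ∑ T ∈ powersetCard k s, ∏ b ∈ T, y b := by
      have hnot : ∀ {j : ℕ}, ∀ T ∈ powersetCard j s, a ∉ T := fun T hT h =>
        ha ((mem_powersetCard.1 hT).1 h)
      rw [powersetCard_succ_insert ha, sum_union, sum_image, mul_sum]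
      · congr 1
        exact sum_congr rfl fun T hT => prod_insert (hnot T hT)
      · intro T hT T' hT' h
        rw [← erase_insert (hnot T hT), ← erase_insert (hnot T' hT')]
        exact congrArg (fun S => S.erase a) h
      · rw [disjoint_left]
        intro T hT hT'
        obtain ⟨T', -, rfl⟩ := mem_image.1 hT'
        exact hnot _ hT (mem_insert_self a T')
    have h₁ := ih hy' (k + 1) m hm
    have h₂ := mul_le_mul_of_nonneg_left (ih hy' k m hm) hya
    have hc₁ : ((n : ℝ) + 1) * n.choose k = (n + 1).choose (k + 1) * (k + 1) := by
      exact_mod_cast Nat.add_one_mul_choose_eq n k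
    have hc₂ : ((n + 1).choose (k + 1) : ℝ) = n.choose k + n.choose (k + 1) := by
      exact_mod_cast Nat.choose_succ_succ n k
    have hag := mul_le_mul_of_nonneg_left (mul_pow_le_add_pow hm0 hM0 k)
      (Nat.cast_nonneg ((n + 1).choose (k + 1)) : (0 : ℝ) ≤ _)
    rw [hsplit]
    refine (add_le_add h₁ h₂).trans ?_
    have hya' : y a = (n + 1) * M - n * m := by linarith
    -- By the recursions for the binomial coefficients the bound obtained from the induction
    -- hypothesis equals `choose * ((k + 1) * M * m ^ k - k * m ^ (k + 1))`.
    have key : (n.choose (k + 1) : ℝ) * m ^ (k + 1) + y a * (n.choose k * m ^ k) =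
        (n + 1).choose (k + 1) * ((k + 1) * (M * m ^ k)) -
          (n + 1).choose (k + 1) * (k * m ^ (k + 1)) := by
      rw [hya']
      have e : (n.choose (k + 1) : ℝ) = (n + 1).choose (k + 1) - n.choose k := by linarith
      rw [e]
      linear_combination (M * m ^ k - m ^ (k + 1)) * hc₁
    rw [key]
    linarith [mul_add ((n + 1).choose (k + 1) : ℝ) (k * m ^ (k + 1)) (M ^ (k + 1))]

/-- A Chernoff bound for sampling without replacement: few of the `k`-subsets of `s` have a large
sum. Maclaurin's inequality replaces independence. -/
theorem card_powersetCard_filter_le {α : Type*} [DecidableEq α] (s : Finset α) (x : α → ℕ)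
    {lam μ : ℝ} (hlam : 0 < lam) (hx : ∀ a ∈ s, (x a : ℝ) ≤ lam)
    (hμ : (∑ a ∈ s, (x a : ℝ)) ≤ #s * μ) (k m : ℕ) (hs : s.Nonempty) :
    (#{T ∈ powersetCard k s | m ≤ ∑ a ∈ T, x a} : ℝ) ≤
      (#s).choose k * Real.exp ((2 * k * μ - m) / lam) := by
  have hs0 : (0 : ℝ) < #s := by exact_mod_cast hs.card_pos
  set y : α → ℝ := fun a => Real.exp (x a / lam) with hy
  set M : ℝ := (∑ a ∈ s, y a) / #s with hMdef
  have hM0 : 0 ≤ M := div_nonneg (sum_nonneg fun a _ => (Real.exp_pos _).le) hs0.le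
  -- As `x a / lam ≤ 1`, the exponential is at most `1 + 2 * x a / lam`.
  have hM : M ≤ Real.exp (2 * μ / lam) := by
    have h₁ : ∀ a ∈ s, y a ≤ 1 + 2 / lam * x a := fun a ha => by
      have h0 : 0 ≤ (x a : ℝ) / lam := by positivity
      have h := Real.abs_exp_sub_one_le (x := x a / lam)
        (by rw [abs_of_nonneg h0]; exact (div_le_one hlam).2 (hx a ha))
      rw [abs_of_nonneg h0] at h
      have h' := (le_abs_self _).trans h
      have e : 2 * ((x a : ℝ) / lam) = 2 / lam * x a := by ring
      linarith
    have h₂ := sum_le_sum h₁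
    rw [sum_add_distrib, ← mul_sum, sum_const, nsmul_eq_mul, mul_one] at h₂
    have h₃ : M ≤ 1 + 2 * μ / lam := by
      rw [hMdef, div_le_iff₀ hs0]
      have h₄ := mul_le_mul_of_nonneg_left hμ (show 0 ≤ 2 / lam by positivity)
      have e : (1 + 2 * μ / lam) * #s = #s + 2 / lam * (#s * μ) := by ring
      linarith
    linarith [Real.add_one_le_exp (2 * μ / lam)]
  have hmac := sum_powersetCard_prod_le s y (fun a _ => (Real.exp_pos _).le) k M
    (by rw [hMdef]; field_simp)
  -- Markov's inequality for `exp ((∑ a ∈ T, x a - m) / lam)`.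
  have hcount : (#{T ∈ powersetCard k s | m ≤ ∑ a ∈ T, x a} : ℝ) ≤
      ∑ T ∈ powersetCard k s, Real.exp (-(m / lam)) * ∏ a ∈ T, y a := by
    rw [card_filter]
    push_cast
    refine sum_le_sum fun T _ => ?_
    rw [hy, ← Real.exp_sum, ← Real.exp_add]
    split_ifs with h
    · refine Real.one_le_exp ?_
      rw [← sum_div, neg_add_eq_sub, ← sub_div]
      refine div_nonneg (sub_nonneg.2 ?_) hlam.le
      exact_mod_cast h
    · exact (Real.exp_pos _).le
  refine hcount.trans ?_
  rw [← mul_sum]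
  calc Real.exp (-(m / lam)) * ∑ T ∈ powersetCard k s, ∏ a ∈ T, y a
      ≤ Real.exp (-(m / lam)) * ((#s).choose k * Real.exp (2 * μ / lam) ^ k) := by
        refine mul_le_mul_of_nonneg_left (hmac.trans ?_) (Real.exp_pos _).le
        gcongr
    _ = (#s).choose k * Real.exp ((2 * k * μ - m) / lam) := by
        rw [← Real.exp_nat_mul, mul_left_comm, ← Real.exp_add]
        congr 2
        ring

/-! ### Almost disjunct matrices from agreements -/

/-- It suffices that every column in `J` has a row in which it is the only column of `J` with
entry `1`. -/
theorem containsPermMatrix_of_private {M N : ℕ} {A : Matrix (Fin M) (Fin N) Bool}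
    {J : Finset (Fin N)}
    (h : ∀ j ∈ J, ∃ r, A r j = true ∧ ∀ j' ∈ J, A r j' = true → j' = j) :
    ContainsPermMatrix A J := by
  rcases J.eq_empty_or_nonempty with rfl | ⟨j₀, hj₀⟩
  · exact ⟨∅, rfl, by simp, by simp⟩
  have : Nonempty (Fin M) := ⟨(h j₀ hj₀).choose⟩
  choose! ρ h₁ h₂ using h
  refine ⟨J.image ρ, card_image_of_injOn fun j hj j' hj' e => ?_, fun i hi => ?_, fun j hj => ?_⟩
  · exact h₂ j' hj' j hj (e ▸ h₁ j hj)
  · obtain ⟨j, hj, rfl⟩ := mem_image.1 hi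
    exact ⟨j, ⟨hj, h₁ j hj⟩, fun j' hj' => h₂ j hj j' hj'.1 hj'.2⟩
  · refine ⟨ρ j, ⟨mem_image_of_mem ρ hj, h₁ j hj⟩, ?_⟩
    rintro i ⟨hi, hij⟩
    obtain ⟨j', hj', rfl⟩ := mem_image.1 hi
    rw [h₂ j' hj' j hj hij]

/-- A matrix is almost disjunct if a set of columns contains a permutation matrix whenever each of
its columns agrees in fewer than `m` places with the others, no two columns agree in more than `lam`
places, and the average number of agreements with a given column is at most `μ`. -/
theorem isType2Disjunct_of_agreements {M N t m : ℕ} {A : Matrix (Fin M) (Fin N) Bool}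
    {ε lam μ : ℝ} (ht : 1 ≤ t) (htN : t < N) (hlam : 0 < lam) (agree : Fin N → Fin N → ℕ)
    (hmax : ∀ j j', j' ≠ j → (agree j j' : ℝ) ≤ lam)
    (havg : ∀ j, (∑ j' ∈ univ.erase j, (agree j j' : ℝ)) ≤ (N - 1 : ℕ) * μ)
    (hperm : ∀ J : Finset (Fin N), (∀ j ∈ J, ∑ j' ∈ J.erase j, agree j j' < m) →
      ContainsPermMatrix A J)
    (hε : (t + 1) * Real.exp ((2 * t * μ - m) / lam) ≤ ε) : IsType2Disjunct t ε A := by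
  set good : Finset (Finset (Fin N)) := {J ∈ powersetCard (t + 1) univ |
    ∀ j ∈ J, ∑ j' ∈ J.erase j, agree j j' < m}
  set bad : Finset (Finset (Fin N)) := {J ∈ powersetCard (t + 1) univ |
    ¬ ∀ j ∈ J, ∑ j' ∈ J.erase j, agree j j' < m}
  refine ⟨good, filter_subset _ _, ?_, fun J hJ => hperm J (mem_filter.1 hJ).2⟩
  have hcard : (#good : ℝ) + #bad = N.choose (t + 1) := by
    have := card_filter_add_card_filter_not (s := powersetCard (t + 1) (univ : Finset (Fin N)))
      (fun J => ∀ j ∈ J, ∑ j' ∈ J.erase j, agree j j' < m)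
    rw [card_powersetCard, card_univ, Fintype.card_fin] at this
    exact_mod_cast this
  have hsub : bad ⊆ univ.biUnion fun j : Fin N =>
      ({T ∈ powersetCard t (univ.erase j) | m ≤ ∑ j' ∈ T, agree j j'}).image (insert j) := by
    intro J hJ
    obtain ⟨hJ, hJ'⟩ := mem_filter.1 hJ
    push Not at hJ'
    obtain ⟨j, hj, hm⟩ := hJ'
    refine mem_biUnion.2 ⟨j, mem_univ j, mem_image.2 ⟨J.erase j, mem_filter.2 ⟨?_, hm⟩,
      insert_erase hj⟩⟩
    refine mem_powersetCard.2 ⟨erase_subset_erase _ (subset_univ J), ?_⟩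
    rw [card_erase_of_mem hj, (mem_powersetCard.1 hJ).2, Nat.add_sub_cancel]
  have hone : ∀ j : Fin N, (#(({T ∈ powersetCard t (univ.erase j) |
      m ≤ ∑ j' ∈ T, agree j j'}).image (insert j)) : ℝ) ≤
      (N - 1).choose t * Real.exp ((2 * t * μ - m) / lam) := fun j => by
    have hc : #((univ : Finset (Fin N)).erase j) = N - 1 := by
      rw [card_erase_of_mem (mem_univ j), card_univ, Fintype.card_fin]
    have h := card_powersetCard_filter_le (univ.erase j) (agree j) hlam
      (fun a ha => hmax j a (ne_of_mem_erase ha)) (by rw [hc]; exact havg j) t m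
      (card_pos.1 (by omega))
    rw [hc] at h
    refine le_trans ?_ h
    exact_mod_cast card_image_le
  have hbadle : (#bad : ℝ) ≤ N * ((N - 1).choose t * Real.exp ((2 * t * μ - m) / lam)) := by
    have h₁ : (#bad : ℝ) ≤ ∑ j : Fin N, (#(({T ∈ powersetCard t (univ.erase j) |
        m ≤ ∑ j' ∈ T, agree j j'}).image (insert j)) : ℝ) := by
      exact_mod_cast (card_le_card hsub).trans card_biUnion_le
    refine h₁.trans ((sum_le_sum fun j _ => hone j).trans ?_)
    simp
  have hchoose : (N : ℝ) * (N - 1).choose t = N.choose (t + 1) * (t + 1) := by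
    obtain ⟨n, rfl⟩ : ∃ n, N = n + 1 := ⟨N - 1, by omega⟩
    exact_mod_cast Nat.add_one_mul_choose_eq n t
  have h := mul_le_mul_of_nonneg_left hε (Nat.cast_nonneg (N.choose (t + 1)) : (0 : ℝ) ≤ _)
  rw [← mul_assoc, hchoose] at hbadle
  nlinarith

/-! ### The code given by the shifts -/

/-- The symbol of column `j` in row `i` of the code given by the shifts `U`. -/
def symbol (q m : ℕ) (U : ℕ → ℕ) (j i : ℕ) : ℕ := (j + U (j / q * m + i)) % q

/-- The binary matrix of the code: every symbol is replaced by a unit column of length `q`. -/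
def codeMatrix (q m N : ℕ) (U : ℕ → ℕ) : Matrix (Fin (q * m)) (Fin N) Bool :=
  fun r j => decide (symbol q m U j (r / q) = r % q)

/-- The number of rows of the code in which two columns have the same symbol. -/
def agreement (q m : ℕ) (U : ℕ → ℕ) (j j' : ℕ) : ℕ :=
  #{i ∈ range m | symbol q m U j i = symbol q m U j' i}

theorem agreement_comm (q m : ℕ) (U : ℕ → ℕ) (j j' : ℕ) :
    agreement q m U j j' = agreement q m U j' j := by
  unfold agreement
  simp only [eq_comm]

theorem eq_of_symbol_eq {q m i j j' : ℕ} {U : ℕ → ℕ} (hb : j / q = j' / q)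
    (h : symbol q m U j i = symbol q m U j' i) : j = j' := by
  unfold symbol at h
  rw [hb] at h
  have h' : j % q = j' % q := Nat.ModEq.add_right_cancel' _ h
  rw [← Nat.div_add_mod j q, ← Nat.div_add_mod j' q, hb, h']

theorem sub_mod_eq_of_symbol_eq {q m i j j' : ℕ} {U : ℕ → ℕ} (hq : 0 < q)
    (hU : U (j' / q * m + i) < q) (h : symbol q m U j i = symbol q m U j' i) :
    (U (j / q * m + i) + q - U (j' / q * m + i)) % q = (j' % q + q - j % q) % q := by
  unfold symbol at h
  set u := U (j / q * m + i)
  set v := U (j' / q * m + i)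
  have hr := Nat.mod_lt j hq
  have hr' := Nat.mod_lt j' hq
  have h₁ : (j % q + u) % q = (j' % q + v) % q := by
    rwa [Nat.mod_add_mod, Nat.mod_add_mod]
  refine Nat.ModEq.add_right_cancel' (v + j % q) ?_
  have e₁ : u + q - v + (v + j % q) = j % q + u + q := by omega
  have e₂ : j' % q + q - j % q + (v + j % q) = j' % q + v + q := by omega
  rw [e₁, e₂]
  exact Nat.ModEq.add_right _ h₁

theorem two_pow_agreement_le {q m N j j' : ℕ} {U : ℕ → ℕ} (hq : 0 < q)
    (hU : Separated q m (N / q + 1) U) (hj : j < N) (hj' : j' < N) (hne : j' ≠ j) :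
    2 ^ agreement q m U j j' * q ^ m ≤ N * (q + 1) ^ m := by
  wlog hlt : j' / q ≤ j / q generalizing j j'
  · rw [agreement_comm]
    exact this hj' hj hne.symm (by omega)
  have hjN : j / q < N / q + 1 := Nat.lt_succ_of_le (Nat.div_le_div_right hj.le)
  rcases hlt.lt_or_eq with hlt | heq
  · have hag : agreement q m U j j' ≤
        hits q m U (j / q) (j' / q) ((j' % q + q - j % q) % q) m := by
      refine card_le_card fun i hi => ?_
      obtain ⟨hi, h⟩ := mem_filter.1 hi
      exact mem_filter.2 ⟨hi, sub_mod_eq_of_symbol_eq hq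
        (hU.1 _ (hlt.trans hjN) i (mem_range.1 hi)) h⟩
    calc 2 ^ agreement q m U j j' * q ^ m
        ≤ 2 ^ hits q m U (j / q) (j' / q) ((j' % q + q - j % q) % q) m * q ^ m := by
          gcongr
          norm_num
      _ ≤ j / q * q * (q + 1) ^ m := hU.2 _ hjN _ hlt _ (Nat.mod_lt _ hq)
      _ ≤ N * (q + 1) ^ m := by
          gcongr
          exact (Nat.div_mul_le_self j q).trans hj.le
  · have hzero : agreement q m U j j' = 0 := by
      refine card_eq_zero.2 (filter_eq_empty_iff.2 fun i _ h => hne ?_)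
      exact (eq_of_symbol_eq heq.symm h).symm
    rw [hzero, pow_zero]
    exact Nat.mul_le_mul (by omega) (Nat.pow_le_pow_left (by omega) m)

/-- Each symbol occurs at most once in a block, so a column shares its symbol in a given row with at
most one column of every other block. -/
theorem card_symbol_eq_le {q m N : ℕ} (U : ℕ → ℕ) (j : Fin N) (i : ℕ) :
    #{j' ∈ univ.erase j | symbol q m U j i = symbol q m U (j' : Fin N) i} ≤ (N - 1) / q := by
  have hle : ∀ k : Fin N, (k : ℕ) / q ≤ (N - 1) / q := fun k =>
    Nat.div_le_div_right (by have := k.2; omega)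
  have hcard : #((range ((N - 1) / q + 1)).erase ((j : ℕ) / q)) = (N - 1) / q := by
    rw [card_erase_of_mem (mem_range.2 (Nat.lt_add_one_of_le (hle j))), card_range,
      Nat.add_sub_cancel]
  rw [← hcard]
  refine card_le_card_of_injOn (fun k : Fin N => (k : ℕ) / q) (fun k hk => ?_)
    fun k hk k' hk' e => ?_
  · simp only [coe_filter, mem_erase, mem_univ, and_true, Set.mem_ofPred_eq] at hk
    simp only [coe_erase, Set.mem_sdiff, mem_coe, mem_range, Set.mem_singleton_iff]
    exact ⟨Nat.lt_succ_of_le (hle k), fun e => hk.1 (Fin.ext (eq_of_symbol_eq e hk.2.symm))⟩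
  · simp only [coe_filter, mem_erase, mem_univ, and_true, Set.mem_ofPred_eq] at hk hk'
    exact Fin.ext (eq_of_symbol_eq e (hk.2.symm.trans hk'.2))

theorem sum_agreement_le {q m N : ℕ} (U : ℕ → ℕ) (j : Fin N) :
    ∑ j' ∈ univ.erase j, agreement q m U j (j' : Fin N) ≤ m * ((N - 1) / q) := by
  unfold agreement
  simp only [card_filter]
  rw [sum_comm]
  have h := sum_le_card_nsmul (range m) (fun i => ∑ j' ∈ univ.erase j,
    if symbol q m U j i = symbol q m U (j' : Fin N) i then 1 else 0) ((N - 1) / q)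
    fun i _ => by
      rw [← card_filter]
      exact card_symbol_eq_le U j i
  rwa [card_range, smul_eq_mul] at h

theorem containsPermMatrix_codeMatrix {q m N : ℕ} (U : ℕ → ℕ) (hq : 0 < q) (J : Finset (Fin N))
    (hJ : ∀ j ∈ J, ∑ j' ∈ J.erase j, agreement q m U j (j' : Fin N) < m) :
    ContainsPermMatrix (codeMatrix q m N U) J := by
  refine containsPermMatrix_of_private fun j hj => ?_
  obtain ⟨i, hi, hpriv⟩ : ∃ i < m, ∀ j' ∈ J.erase j,
      symbol q m U j i ≠ symbol q m U (j' : Fin N) i := by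
    by_contra! h
    have hsub : range m ⊆ (J.erase j).biUnion fun j' =>
        {i ∈ range m | symbol q m U j i = symbol q m U (j' : Fin N) i} := fun i hi => by
      obtain ⟨j', hj', e⟩ := h i (mem_range.1 hi)
      exact mem_biUnion.2 ⟨j', hj', mem_filter.2 ⟨hi, e⟩⟩
    have h₁ := (card_le_card hsub).trans card_biUnion_le
    rw [card_range] at h₁
    exact absurd (hJ j hj) (not_lt.2 h₁)
  have hs : symbol q m U j i < q := Nat.mod_lt _ hq
  have hr : q * i + symbol q m U j i < q * m := by
    have := Nat.mul_le_mul_left q (Nat.succ_le_of_lt hi)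
    rw [Nat.mul_succ] at this
    omega
  have e₁ : (q * i + symbol q m U j i) / q = i := by
    rw [Nat.mul_add_div hq, Nat.div_eq_of_lt hs, add_zero]
  have e₂ : (q * i + symbol q m U j i) % q = symbol q m U j i := by
    rw [Nat.mul_add_mod, Nat.mod_eq_of_lt hs]
  refine ⟨⟨_, hr⟩, ?_, fun j' hj' h => ?_⟩
  · simp [codeMatrix, e₁, e₂]
  · simp only [codeMatrix, e₁, e₂, decide_eq_true_eq] at h
    by_contra hne
    exact hpriv j' (mem_erase.2 ⟨hne, hj'⟩) h.symm

theorem agreement_le {q m N j j' : ℕ} {U : ℕ → ℕ} (hq : 0 < q)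
    (hU : Separated q m (N / q + 1) U) (hj : j < N) (hj' : j' < N) (hne : j' ≠ j) :
    (agreement q m U j j' : ℝ) ≤ (Real.log N + m / q) / Real.log 2 := by
  have h : (2 : ℝ) ^ agreement q m U j j' * (q : ℝ) ^ m ≤ N * ((q : ℝ) + 1) ^ m := by
    exact_mod_cast two_pow_agreement_le hq hU hj hj' hne
  have hq' : (0 : ℝ) < q := by exact_mod_cast hq
  have hN : (0 : ℝ) < N := by exact_mod_cast (Nat.zero_le j).trans_lt hj
  have h2 : (2 : ℝ) ^ agreement q m U j j' ≤ N * Real.exp (m / q) := by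
    have h₁ : ((q : ℝ) + 1) ^ m ≤ (q : ℝ) ^ m * Real.exp (m / q) := by
      have h₂ : (q : ℝ) + 1 ≤ q * Real.exp (1 / q) := by
        have := mul_le_mul_of_nonneg_left (Real.add_one_le_exp (1 / (q : ℝ))) hq'.le
        rwa [mul_add, mul_one, mul_one_div_cancel hq'.ne', add_comm] at this
      calc ((q : ℝ) + 1) ^ m ≤ (q * Real.exp (1 / q)) ^ m := by gcongr
        _ = (q : ℝ) ^ m * Real.exp (m / q) := by
          rw [mul_pow, ← Real.exp_nat_mul, mul_one_div]
    have h₃ : (2 : ℝ) ^ agreement q m U j j' * (q : ℝ) ^ m ≤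
        N * Real.exp (m / q) * (q : ℝ) ^ m := by
      refine h.trans ((mul_le_mul_of_nonneg_left h₁ hN.le).trans (le_of_eq ?_))
      ring
    exact le_of_mul_le_mul_right h₃ (by positivity)
  have h4 := Real.log_le_log (by positivity) h2
  rw [Real.log_pow, Real.log_mul hN.ne' (Real.exp_pos _).ne', Real.log_exp] at h4
  rwa [le_div_iff₀ (Real.log_pos one_lt_two)]

/-- The matrix of a code with `q` symbols and `m` rows is almost disjunct once `q` is large compared
to `t` and to `L = log (2 (t + 1) / ε)`, and `m` is large compared to `L * log N`. -/
theorem isType2Disjunct_codeMatrix {t N q m : ℕ} {U : ℕ → ℕ} {ε L : ℝ} (ht : 1 ≤ t) (htN : t < N)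
    (hε : 0 < ε) (hL : L = Real.log (2 * (t + 1) / ε))
    (hqt : 4 * t ≤ q) (hqL : 4 * L ≤ q * Real.log 2)
    (hm : 4 * L * Real.log N ≤ m * Real.log 2) (hU : Separated q m (N / q + 1) U) :
    IsType2Disjunct t ε (codeMatrix q m N U) := by
  have hq : 0 < q := by omega
  have hq' : (0 : ℝ) < q := by exact_mod_cast hq
  have hlog2 := Real.log_pos one_lt_two
  have hlogN : 0 < Real.log N := Real.log_pos (by exact_mod_cast (by omega : 1 < N))
  have hlam : 0 < (Real.log N + m / q) / Real.log 2 := by positivity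
  refine isType2Disjunct_of_agreements (m := m) (μ := m / q) ht htN hlam
    (fun j j' => agreement q m U j j') (fun j j' hne => agreement_le hq hU j.2 j'.2
      fun h => hne (Fin.ext h)) (fun j => ?_) (containsPermMatrix_codeMatrix U hq) ?_
  · have h : (∑ j' ∈ univ.erase j, (agreement q m U j (j' : Fin N) : ℝ)) ≤
        m * (((N - 1) / q : ℕ) : ℝ) := by
      exact_mod_cast sum_agreement_le U j
    refine h.trans ?_
    calc (m : ℝ) * (((N - 1) / q : ℕ) : ℝ) ≤ m * (((N - 1 : ℕ) : ℝ) / q) := by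
          gcongr
          exact Nat.cast_div_le
      _ = ((N - 1 : ℕ) : ℝ) * (m / q) := by ring
  · set lam := (Real.log N + m / q) / Real.log 2 with hlamdef
    have hlamL : 2 * L * lam ≤ m := by
      have h₁ : 4 * L * (m / q) ≤ m * Real.log 2 := by
        have := mul_le_mul_of_nonneg_right hqL (show (0 : ℝ) ≤ m / q by positivity)
        have e : (q : ℝ) * Real.log 2 * (m / q) = m * Real.log 2 := by field_simp
        linarith
      rw [hlamdef, ← mul_div_assoc, div_le_iff₀ hlog2]
      linarith
    have h₂ : 2 * t * (m / q : ℝ) ≤ m / 2 := by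
      have hqt' : 4 * (t : ℝ) ≤ q := by exact_mod_cast hqt
      rw [← mul_div_assoc, div_le_iff₀ hq']
      have := mul_le_mul_of_nonneg_left hqt' (Nat.cast_nonneg m : (0 : ℝ) ≤ m)
      linarith
    have h₃ : (2 * t * (m / q : ℝ) - m) / lam ≤ -L := by
      rw [div_le_iff₀ hlam]
      linarith
    have h₄ : Real.exp (-L) = ε / (2 * (t + 1)) := by
      rw [Real.exp_neg, hL, Real.exp_log (by positivity), inv_div]
    calc ((t : ℝ) + 1) * Real.exp ((2 * t * (m / q : ℝ) - m) / lam)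
        ≤ (t + 1) * Real.exp (-L) := by gcongr
      _ = ε / 2 := by rw [h₄]; field_simp
      _ ≤ ε := by linarith

end Code

/-! ### The bounds in terms of `t`, `N` and `ε` -/

/-- The number of rows of the constructed matrix is `O(t * L * log N)`. As `L < a * t`, this is at
most the bound of the theorem, because `log x ≤ 2 * sqrt x` for `x = 4 * a * t / L`. -/
theorem mul_le_sqrt_div_log {a t L : ℝ} (ha : 0 < a) (ht : 0 < t) (hL : 0 < L) (hLt : L < a * t) :
    t * L ≤ 4 * √a * (t ^ (3 / 2 : ℝ) *
      (√L / (Real.log t - Real.log L + Real.log (4 * a)))) := by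
  have hD : Real.log t - Real.log L + Real.log (4 * a) = Real.log (4 * a * t / L) := by
    rw [Real.log_div (by positivity) hL.ne', Real.log_mul (by positivity) ht.ne']
    ring
  have h4 : 4 < 4 * a * t / L := by
    rw [lt_div_iff₀ hL]
    linarith
  have hDpos : 0 < Real.log (4 * a * t / L) := Real.log_pos (by linarith)
  have hsL : 0 < √L := Real.sqrt_pos.2 hL
  have hDle : Real.log (4 * a * t / L) * √L ≤ 4 * √a * √t := by
    have h₁ : Real.log (4 * a * t / L) ≤ 2 * √(4 * a * t / L) := by
      have := Real.log_le_sub_one_of_pos (Real.sqrt_pos.2 (by linarith : 0 < 4 * a * t / L))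
      rw [Real.log_sqrt (by linarith)] at this
      linarith
    have h₂ : √(4 * a * t / L) * √L = 2 * (√a * √t) := by
      rw [← Real.sqrt_mul (by linarith), div_mul_cancel₀ _ hL.ne', Real.sqrt_mul (by positivity),
        Real.sqrt_mul (by norm_num), show (4 : ℝ) = 2 ^ 2 by norm_num,
        Real.sqrt_sq (by norm_num)]
      ring
    calc Real.log (4 * a * t / L) * √L ≤ 2 * √(4 * a * t / L) * √L := by gcongr
      _ = 4 * √a * √t := by rw [mul_assoc, h₂]; ring
  have ht32 : t ^ (3 / 2 : ℝ) = t * √t := by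
    rw [show (3 / 2 : ℝ) = 1 + 1 / 2 by norm_num, Real.rpow_add ht, Real.rpow_one,
      Real.sqrt_eq_rpow]
  rw [hD, ht32, ← mul_div_assoc, ← mul_div_assoc, le_div_iff₀ hDpos]
  calc t * L * Real.log (4 * a * t / L) = t * √L * (Real.log (4 * a * t / L) * √L) := by
        nth_rewrite 1 [← Real.mul_self_sqrt hL.le]
        ring
    _ ≤ t * √L * (4 * √a * √t) := by gcongr
    _ = 4 * √a * (t * √t * √L) := by ring

theorem natLog_two_mul_log_le {x : ℕ} (hx : x ≠ 0) :
    (Nat.log 2 x : ℝ) * Real.log 2 ≤ Real.log x := by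
  rw [← Real.log_pow]
  exact Real.log_le_log (by positivity) (by exact_mod_cast Nat.pow_log_le_self 2 hx)

/-- The number `l` computed by the algorithm approximates `log (2 * (t + 1) / ε) / log 2` up to
additive constants. -/
theorem log_ratio_bounds {t : ℕ} {ε : ℝ} {e : ℚ} (hε : 0 < ε) (hε1 : ε ≤ 1)
    (he1 : ε / 2 ≤ (e : ℝ)) (he2 : (e : ℝ) ≤ ε) :
    Real.log (2 * (t + 1) / ε) ≤
        (Nat.log 2 (2 * ((t + 1) * e.den) / e.num.natAbs) + 1) * Real.log 2 ∧
      Nat.log 2 (2 * ((t + 1) * e.den) / e.num.natAbs) * Real.log 2 ≤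
        Real.log (2 * (t + 1) / ε) + Real.log 2 := by
  have hepos : (0 : ℝ) < e := by linarith
  have hnum : 0 < e.num := Rat.num_pos.2 (by exact_mod_cast hepos)
  have hnum' : 0 < e.num.natAbs := Int.natAbs_pos.2 hnum.ne'
  have heq : (e : ℝ) = e.num.natAbs / e.den := by
    have h : ((e.num.natAbs : ℕ) : ℤ) = e.num := Int.natAbs_of_nonneg hnum.le
    conv_lhs => rw [Rat.cast_def, ← h]
    simp
  set x := 2 * ((t + 1) * e.den) / e.num.natAbs with hx
  have hden : (0 : ℝ) < e.den := by exact_mod_cast e.den_pos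
  have hnumR : (0 : ℝ) < e.num.natAbs := by exact_mod_cast hnum'
  have hratio : 2 * ((t : ℝ) + 1) / e = ((2 * ((t + 1) * e.den) : ℕ) : ℝ) / e.num.natAbs := by
    rw [heq]
    push_cast
    field_simp
  have hxle : (x : ℝ) ≤ 2 * (t + 1) / e := by
    rw [hratio]
    exact Nat.cast_div_le
  have hltx : 2 * ((t : ℝ) + 1) / e < x + 1 := by
    rw [hratio, div_lt_iff₀ hnumR]
    exact_mod_cast (Nat.div_lt_iff_lt_mul hnum').1 (Nat.lt_succ_self x)
  have hx0 : x ≠ 0 := by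
    rintro h
    rw [h, Nat.cast_zero, zero_add, div_lt_one hepos] at hltx
    have : (0 : ℝ) ≤ t := Nat.cast_nonneg t
    linarith
  have ht1 : (0 : ℝ) < 2 * (t + 1) := by positivity
  constructor
  · have h₁ : 2 * ((t : ℝ) + 1) / ε ≤ 2 ^ (Nat.log 2 x + 1) := by
      have h₂ : 2 * ((t : ℝ) + 1) / ε ≤ 2 * (t + 1) / e := by gcongr
      have h₃ : ((x + 1 : ℕ) : ℝ) ≤ ((2 ^ (Nat.log 2 x + 1) : ℕ) : ℝ) := by
        exact_mod_cast Nat.lt_pow_succ_log_self one_lt_two x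
      push_cast at h₃
      linarith
    have h := Real.log_le_log (by positivity) h₁
    rw [Real.log_pow] at h
    exact_mod_cast h
  · refine (natLog_two_mul_log_le hx0).trans ?_
    rw [← Real.log_mul (by positivity) (by norm_num)]
    refine Real.log_le_log (by positivity) (hxle.trans ?_)
    rw [div_le_iff₀ hepos]
    have h := mul_le_mul_of_nonneg_left he1 (show 0 ≤ 2 * ((t : ℝ) + 1) / ε * 2 by positivity)
    have e₁ : 2 * ((t : ℝ) + 1) / ε * 2 * (ε / 2) = 2 * (t + 1) := by field_simp
    linarith

/-- For every constant `a > 1` there is one polynomial-time program which constructs, for all `t`,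
`N` and `ε` with `ε > 2 (t + 1) e ^ (-a t)`, a type-2 `(t, ε)`-disjunct matrix with `N` columns and
the stated number of rows. The real number `ε` is given to the program as a rational number `e`,
which may be `ε` itself if `ε` is rational, or any approximation with `ε / 2 ≤ e ≤ ε`. -/
theorem theorem2 (a : ℝ) (ha : 1 < a) :
    ∃ (C : ℝ) (P : Ram.Prog) (p : Polynomial ℕ), 0 < C ∧
      ∀ (t N : ℕ) (ε : ℝ) (e : ℚ), 1 ≤ t → t < N →
        2 * ((t : ℝ) + 1) * Real.exp (-(a * t)) < ε → ε ≤ 1 →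
        ε / 2 ≤ (e : ℝ) → (e : ℝ) ≤ ε →
        ∃ (M : ℕ) (A : Matrix (Fin M) (Fin N) Bool),
          Ram.OutputsMatrixWithin P [N, t, e.num.natAbs, e.den] A
            (p.eval (N + t + e.num.natAbs.size + e.den.size)) ∧
          IsType2Disjunct t ε A ∧
          (M : ℝ) ≤ C * ((t : ℝ) ^ (3 / 2 : ℝ) * Real.log N *
            (Real.sqrt (Real.log (2 * ((t : ℝ) + 1) / ε)) /
              (Real.log t - Real.log (Real.log (2 * ((t : ℝ) + 1) / ε)) + Real.log (4 * a)))) := by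
  -- `q ≤ 4 (1 + 3 a) t` and `m ≤ 36 L log N`; `mul_le_sqrt_div_log` contributes `4 √a`.
  refine ⟨576 * (1 + 3 * a) * √a, Ram.constructProg,
    Polynomial.C (21 * 10 ^ 7) * (Polynomial.X + 1) ^ 7, by positivity,
    fun t N ε e ht htN hεlow hε1 he1 he2 => ?_⟩
  have hε : 0 < ε := lt_trans (by positivity) hεlow
  have hlog2 := Real.log_pos one_lt_two
  have hlog2gt : (2 / 3 : ℝ) < Real.log 2 := by linarith [Real.log_two_gt_d9]
  have htR : (1 : ℝ) ≤ t := by exact_mod_cast ht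
  obtain ⟨hLl, hlL⟩ := log_ratio_bounds (t := t) hε hε1 he1 he2
  set L := Real.log (2 * ((t : ℝ) + 1) / ε) with hL
  obtain ⟨n, hn⟩ : ∃ n, n = N + t + e.num.natAbs.size + e.den.size := ⟨_, rfl⟩
  obtain ⟨l, hl⟩ : ∃ l, l = Nat.log 2 (2 * ((t + 1) * e.den) / e.num.natAbs) := ⟨_, rfl⟩
  obtain ⟨lN, hlN⟩ : ∃ lN, lN = Nat.log 2 N := ⟨_, rfl⟩
  obtain ⟨q, hq⟩ : ∃ q, q = 4 * (t + l + 1) := ⟨_, rfl⟩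
  obtain ⟨m, hm⟩ : ∃ m, m = 4 * (l + 1) * (lN + 1) := ⟨_, rfl⟩
  rw [← hl] at hLl hlL
  have hqR : (q : ℝ) = 4 * (t + l + 1) := by exact_mod_cast hq
  have hmR : (m : ℝ) = 4 * (l + 1) * (lN + 1) := by exact_mod_cast hm
  have hL2 : 2 * Real.log 2 ≤ L := by
    rw [two_mul, ← Real.log_mul two_ne_zero two_ne_zero, hL]
    refine Real.log_le_log (by norm_num) ?_
    rw [le_div_iff₀ hε]
    linarith
  have hLpos : 0 < L := by linarith
  have hLat : L < a * t := by
    rw [hL, Real.log_lt_iff_lt_exp (by positivity), div_lt_iff₀ hε]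
    have h := mul_lt_mul_of_pos_left hεlow (Real.exp_pos (a * t))
    have e₁ : Real.exp (a * t) * (2 * ((t : ℝ) + 1) * Real.exp (-(a * t))) = 2 * (t + 1) := by
      rw [mul_left_comm, ← Real.exp_add, add_neg_cancel, Real.exp_zero, mul_one]
    linarith
  have hN2 : (2 : ℝ) ≤ N := by exact_mod_cast (by omega : 2 ≤ N)
  have hlogN2 : Real.log 2 ≤ Real.log N := Real.log_le_log (by norm_num) hN2
  have hlNle : lN * Real.log 2 ≤ Real.log N := by
    rw [hlN]
    exact natLog_two_mul_log_le (by omega)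
  have hlNge : Real.log N ≤ (lN + 1) * Real.log 2 := by
    have h : (N : ℝ) ≤ 2 ^ (lN + 1) := by
      rw [hlN]
      exact_mod_cast (Nat.lt_pow_succ_log_self one_lt_two N).le
    have h' := Real.log_le_log (by linarith) h
    rw [Real.log_pow] at h'
    exact_mod_cast h'
  obtain ⟨τ, T, hrun, hT, -, U, hU, h1, h2⟩ :=
    Ram.constructProg_halts (N := N) (t := t) (num := e.num.natAbs) (den := e.den)
      (by omega) hn hl hlN hq hm rfl
  refine ⟨q * m, codeMatrix q m N U, ⟨τ, T, hrun, hT.trans ?_, h1, fun i j => ?_⟩, ?_, ?_⟩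
  · rw [← hn]
    simp only [Polynomial.eval_mul, Polynomial.eval_C, Polynomial.eval_pow, Polynomial.eval_add,
      Polynomial.eval_X, Polynomial.eval_one]
    have h : 20 * (n + 1) ^ 2 + 1 ≤ 21 * (n + 1) ^ 2 := by
      have : 1 ≤ (n + 1) ^ 2 := Nat.one_le_pow _ _ (by omega)
      omega
    calc 10 ^ 7 * (n + 1) ^ 5 * (20 * (n + 1) ^ 2 + 1)
        ≤ 10 ^ 7 * (n + 1) ^ 5 * (21 * (n + 1) ^ 2) := Nat.mul_le_mul_left _ h
      _ = 21 * 10 ^ 7 * (n + 1) ^ 7 := by ring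
  · rw [h2 i i.2 j j.2, codeMatrix, symbol]
    split_ifs with h <;> simp [h]
  · refine isType2Disjunct_codeMatrix ht htN hε hL (by omega) ?_ ?_ hU
    · rw [hqR]
      nlinarith
    · have h₁ : L * Real.log N ≤ (l + 1) * Real.log 2 * ((lN + 1) * Real.log 2) := by gcongr
      have h₂ : (l + 1) * Real.log 2 * ((lN + 1) * Real.log 2) ≤
          (l + 1) * 1 * ((lN + 1) * Real.log 2) := by
        gcongr
        linarith [Real.log_two_lt_d9]
      rw [hmR]
      linarith
  · have hl3 : (l : ℝ) + 1 ≤ 3 * L := by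
      refine le_of_mul_le_mul_right ?_ hlog2
      nlinarith
    have hlN3 : (lN : ℝ) + 1 ≤ 3 * Real.log N := by
      refine le_of_mul_le_mul_right ?_ hlog2
      nlinarith
    have hq3 : (q : ℝ) ≤ 4 * ((1 + 3 * a) * t) := by
      rw [hqR]
      linarith
    have hm3 : (m : ℝ) ≤ 4 * (3 * L) * (3 * Real.log N) := by
      rw [hmR]
      gcongr
    push_cast
    calc (q : ℝ) * m ≤ 4 * ((1 + 3 * a) * t) * (4 * (3 * L) * (3 * Real.log N)) := by gcongr
      _ = 144 * (1 + 3 * a) * Real.log N * (t * L) := by ring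
      _ ≤ 144 * (1 + 3 * a) * Real.log N * (4 * √a * ((t : ℝ) ^ (3 / 2 : ℝ) *
          (√L / (Real.log t - Real.log L + Real.log (4 * a))))) := by
        have := mul_le_sqrt_div_log (by linarith) (by linarith : (0 : ℝ) < t) hLpos hLat
        gcongr
      _ = _ := by ring
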